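/- Let $p\in(0,1)$ and let $m$ be any probability measure on $(0,\infty)$. **Dynamics.** A configuration consists of particles $\bullet_i$ with distinct initial locations $x_i\in\mathbb R$, velocities $v_i\in\{-1,0,+1\}$ and spins $s_i\in\{-1,+1\}$. Each particle moves at constant velocity $v_i$ from $x_i$ until it is annihilated. When exactly two particles collide, both are annihilated. When three particles collide (necessarily one static, one right-moving and one left-moving), the static particle, of spin $s$, and the moving particle of velocity $-s$ are annihilated, while the moving particle of velocity $s$ continues unperturbed. Annihilated particles are removed and take no part in later collisions. A particle survives if it is never annihilated. **Half-line process** (probability $\mathbb P$, expectation $\mathbb E$). The particles $\bullet_1,\bullet_2,\dots$ start from $0<x_1<x_2<\cdots$, where $x_1,x_2-x_1,x_3-x_2,\dots$ are i.i.d. with law $m$; the velocities are i.i.d. with $\mathbb P(v_n=0)=p$ and $\mathbb P(v_n=1)=\mathbb P(v_n=-1)=\frac{1-p}2$; the spins are i.i.d. uniform on $\{-1,+1\}$; and locations, velocities and spins are independent. **Full-line process** (probability $\mathbb P_{\mathbb R}$). The particles $(\bullet_n)_{n\in\mathbb Z}$ start from $\cdots<x_{-1}<x_0=0<x_1<\cdots$,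 where the distances $x_{n}-x_{n-1}$, $n\in\mathbb Z$, are i.i.d. with law $m$, and the velocities and spins, indexed by $\mathbb Z$, are distributed and independent as above. Let $$\theta(p)=\mathbb P_{\mathbb R}\bigl(\bullet_0\text{ survives}\mid v_0=0\bigr).$$ For $k\ge1$ let $N_k$ be the number of surviving particles of velocity $0$ minus the number of surviving particles of velocity $-1$ in the system consisting only of the first $k$ particles $\bullet_1,\dots,\bullet_k$ of the half-line process. **Proposition.** For every $p\in(0,1)$, $$\theta(p)>0\iff\text{there is } k\ge1\text{ such that }\mathbb E[N_k]>0.$$ -/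

import Mathlib

open MeasureTheory ProbabilityTheory

namespace BallisticAnnihilation

noncomputable section

/-! ### Deterministic dynamics -/

/-- An initial configuration of particles indexed by `ι`: locations on the line, velocities in
`{-1, 0, +1}`, and spins in `{-1, +1}` (used only at triple collisions). -/
structure Config (ι : Type*) where
  pos : ι → ℝ
  vel : ι → SignType
  spin : ι → ℤˣ

namespace Config

variable {ι : Type*}

/-- The virtual trajectory of particle `i`, i.e. its location at time `t` in absence of any other
particle. -/
def traj (c : Config ι) (i : ι) (t : ℝ) : ℝ := c.pos i + (c.vel i : ℝ) * t

/-- Particles `i` and `j` virtually collide at time `t`. -/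
def Meet (c : Config ι) (i j : ι) (t : ℝ) : Prop :=
  i ≠ j ∧ 0 ≤ t ∧ c.traj i t = c.traj j t

/-- In a triple collision between `i`, `j` and `k`, the spin rule lets `k` survive: one of `i`, `j`
is static, and its spin is the velocity of `k`. -/
def Spares (c : Config ι) (i j k : ι) : Prop :=
  (c.vel i = 0 ∧ (c.vel k : ℤ) = (c.spin i : ℤ)) ∨ (c.vel j = 0 ∧ (c.vel k : ℤ) = (c.spin j : ℤ))

/-- `c.Annihilate S i j t`: in the process restricted to the particles whose index is in `S`,
particles `i` and `j` annihilate each other at time `t`.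

This is the recursive rule: `i` and `j` are present and virtually collide at time `t`, and every
other present particle `k` that virtually collides with `i` or `j` at some time `u ≤ t` either is
spared by the spin rule in a triple collision of `i`, `j`, `k` at time `u = t`, or has been
annihilated, at or before time `u`, together with a particle `k'` (here `partner k`, at time
`time k`) other than `i` and `j`. (The case where `k` is annihilated precisely at time `u` is the
one where `i` or `j` is spared in a triple collision with `k` and `k'`.)
See `annihilate_iff` for the same rule with existential quantifiers. -/
inductive Annihilate (c : Config ι) (S : Set ι) : ι → ι → ℝ → Prop
  | intro {i j : ι} {t : ℝ} (hi : i ∈ S) (hj : j ∈ S) (hmeet : c.Meet i j t)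
      (partner : ι → ι) (time : ι → ℝ)
      (hne : ∀ k ∈ S, k ≠ i → k ≠ j → ∀ u ≤ t, (c.Meet k i u ∨ c.Meet k j u) →
        ¬ (u = t ∧ c.Spares i j k) → partner k ≠ i ∧ partner k ≠ j ∧ time k ≤ u)
      (hann : ∀ k ∈ S, k ≠ i → k ≠ j → ∀ u ≤ t, (c.Meet k i u ∨ c.Meet k j u) →
        ¬ (u = t ∧ c.Spares i j k) → Annihilate c S k (partner k) (time k)) :
      Annihilate c S i j t

/-- Particle `i` survives forever in the process restricted to the particles indexed by `S`. -/
def Survives (c : Config ι) (S : Set ι) (i : ι) : Prop :=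
  i ∈ S ∧ ∀ j t, ¬ c.Annihilate S i j t

theorem Meet.symm {c : Config ι} {i j : ι} {t : ℝ} (h : c.Meet i j t) : c.Meet j i t :=
  ⟨h.1.symm, h.2.1, h.2.2.symm⟩

theorem Spares.symm {c : Config ι} {i j k : ι} (h : c.Spares i j k) : c.Spares j i k :=
  Or.symm h

theorem Annihilate.symm {c : Config ι} {S : Set ι} {i j : ι} {t : ℝ}
    (h : c.Annihilate S i j t) : c.Annihilate S j i t := by
  cases h with
  | intro hi hj hm p τ hne hann =>
    refine .intro hj hi hm.symm p τ ?_ ?_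
    · intro k hk hkj hki u hu h1 h2
      obtain ⟨a, b, d⟩ := hne k hk hki hkj u hu h1.symm fun h => h2 ⟨h.1, h.2.symm⟩
      exact ⟨b, a, d⟩
    · intro k hk hkj hki u hu h1 h2
      exact hann k hk hki hkj u hu h1.symm fun h => h2 ⟨h.1, h.2.symm⟩

/-- Two distinct virtual trajectories with distinct starting points meet at most once. -/
theorem Meet.time_unique {c : Config ι} {i j : ι} {t u : ℝ} (hp : c.pos i ≠ c.pos j)
    (h : c.Meet i j t) (h' : c.Meet i j u) : t = u := by
  have h1 := h.2.2
  have h2 := h'.2.2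
  simp only [traj] at h1 h2
  by_cases hv : (c.vel i : ℝ) = (c.vel j : ℝ)
  · rw [hv] at h1
    exact absurd (by linarith) hp
  · have h3 : ((c.vel i : ℝ) - (c.vel j : ℝ)) * (t - u) = 0 := by linarith
    rcases mul_eq_zero.1 h3 with h4 | h4
    · exact absurd (by linarith) hv
    · linarith

/-- The recursive rule for annihilations. -/
theorem annihilate_iff {c : Config ι} (hc : Function.Injective c.pos) {S : Set ι} {i j : ι}
    {t : ℝ} :
    c.Annihilate S i j t ↔ i ∈ S ∧ j ∈ S ∧ c.Meet i j t ∧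
      ∀ k ∈ S, k ≠ i → k ≠ j → ∀ u ≤ t, (c.Meet k i u ∨ c.Meet k j u) →
        (u = t ∧ c.Spares i j k) ∨
        ∃ k' u', k' ≠ i ∧ k' ≠ j ∧ u' ≤ u ∧ c.Annihilate S k k' u' := by
  classical
  constructor
  · rintro ⟨hi, hj, hm, p, τ, hne, hann⟩
    refine ⟨hi, hj, hm, fun k hk hki hkj u hu h1 => ?_⟩
    by_cases h2 : u = t ∧ c.Spares i j k
    · exact Or.inl h2
    · obtain ⟨a, b, d⟩ := hne k hk hki hkj u hu h1 h2
      exact Or.inr ⟨p k, τ k, a, b, d, hann k hk hki hkj u hu h1 h2⟩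
  · rintro ⟨hi, hj, hm, h⟩
    -- a common choice of partner and time for all `u`: take it for the smallest critical `u`
    have key : ∀ k, ∃ k' u', ∀ (_ : k ∈ S) (_ : k ≠ i) (_ : k ≠ j), ∀ u ≤ t,
        (c.Meet k i u ∨ c.Meet k j u) → ¬ (u = t ∧ c.Spares i j k) →
        (k' ≠ i ∧ k' ≠ j ∧ u' ≤ u) ∧ c.Annihilate S k k' u' := by
      intro k
      by_cases hex : k ∈ S ∧ k ≠ i ∧ k ≠ j ∧ ∃ u ≤ t, (c.Meet k i u ∨ c.Meet k j u) ∧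
          ¬ (u = t ∧ c.Spares i j k)
      · obtain ⟨hk, hki, hkj, u₀, hu₀, hm₀, hs₀⟩ := hex
        have hmin : ∃ v ≤ t, (c.Meet k i v ∨ c.Meet k j v) ∧ ¬ (v = t ∧ c.Spares i j k) ∧
            ∀ u ≤ t, (c.Meet k i u ∨ c.Meet k j u) → ¬ (u = t ∧ c.Spares i j k) → v ≤ u := by
          by_cases hlt : ∃ w ≤ t, (c.Meet k i w ∨ c.Meet k j w) ∧
              ¬ (w = t ∧ c.Spares i j k) ∧ w < u₀
          · obtain ⟨w, hw, hmw, hsw, hwu⟩ := hlt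
            refine ⟨w, hw, hmw, hsw, fun u _ hmu _ => ?_⟩
            have e1 := fun {a b : ℝ} (x : c.Meet k i a) (y : c.Meet k i b) =>
              x.time_unique (hc.ne hki) y
            have e2 := fun {a b : ℝ} (x : c.Meet k j a) (y : c.Meet k j b) =>
              x.time_unique (hc.ne hkj) y
            rcases hm₀ with a | a <;> rcases hmw with b | b <;> rcases hmu with d | d
            · exact (e1 b d).le
            · exact absurd (e1 a b) hwu.ne'
            · have := e1 a d; linarith
            · exact (e2 b d).le
            · exact (e1 b d).le
            · have := e2 a d; linarith
            · exact absurd (e2 a b) hwu.ne'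
            · exact (e2 b d).le
          · exact ⟨u₀, hu₀, hm₀, hs₀, fun u hu hmu hsu =>
              not_lt.1 fun hl => hlt ⟨u, hu, hmu, hsu, hl⟩⟩
        obtain ⟨v, hv, hmv, hsv, hle⟩ := hmin
        rcases h k hk hki hkj v hv hmv with hh | ⟨k', u', a, b, d, e⟩
        · exact absurd hh hsv
        · exact ⟨k', u', fun _ _ _ u hu h1 h2 => ⟨⟨a, b, d.trans (hle u hu h1 h2)⟩, e⟩⟩
      · exact ⟨k, 0, fun hk hki hkj u hu h1 h2 =>
          absurd ⟨hk, hki, hkj, u, hu, h1, h2⟩ hex⟩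
    choose p τ hp using key
    exact .intro hi hj hm p τ (fun k hk hki hkj u hu h1 h2 => (hp k hk hki hkj u hu h1 h2).1)
      (fun k hk hki hkj u hu h1 h2 => (hp k hk hki hkj u hu h1 h2).2)

end Config

/-! ### Random configurations -/

instance instMeasurableSpaceSignType : MeasurableSpace SignType := ⊤

/-- The law of a velocity: `0` with probability `p`, and `±1` with probability `(1 - p) / 2`
each. -/
def velocityLaw (p : ℝ) : Measure SignType :=
  ENNReal.ofReal p • Measure.dirac 0 + ENNReal.ofReal ((1 - p) / 2) • Measure.dirac 1 +
    ENNReal.ofReal ((1 - p) / 2) • Measure.dirac (-1)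

/-- The law of a spin: a Rademacher variable. -/
def spinLaw : Measure ℤˣ :=
  (2⁻¹ : ENNReal) • Measure.dirac 1 + (2⁻¹ : ENNReal) • Measure.dirac (-1)

/-- The data attached to a particle: the distance from the preceding location (on its left), its
velocity, and its spin. -/
abbrev Mark : Type := Set.Ioi (0 : ℝ) × SignType × ℤˣ

/-- The law of the data of a particle: interdistance of law `m`, velocity, and spin are
independent. -/
def markLaw (m : Measure (Set.Ioi (0 : ℝ))) (p : ℝ) : Measure Mark :=
  m.prod ((velocityLaw p).prod spinLaw)

/-- The law `ℙ` of the data of the half-line process: an i.i.d. sequence of marks. Particles are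
numbered from `0`: the first particle to the right of the origin has index `0`. -/
def halfLineLaw (m : Measure (Set.Ioi (0 : ℝ))) (p : ℝ) : Measure (ℕ → Mark) :=
  Measure.infinitePi fun _ => markLaw m p

/-- The law `ℙ_ℝ` of the data of the full-line process: a two-sided i.i.d. sequence of marks. -/
def fullLineLaw (m : Measure (Set.Ioi (0 : ℝ))) (p : ℝ) : Measure (ℤ → Mark) :=
  Measure.infinitePi fun _ => markLaw m p

/-- The half-line configuration: the locations form a renewal process on `(0, ∞)`; the first
particle is at distance `(ω 0).1` from the origin. -/
def halfLine (ω : ℕ → Mark) : Config ℕ where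
  pos n := ∑ i ∈ Finset.range (n + 1), ((ω i).1 : ℝ)
  vel n := (ω n).2.1
  spin n := (ω n).2.2

/-- The full-line configuration: particle `0` is at the origin, and `(ω n).1` is the distance
between particles `n - 1` and `n`, for every integer `n`. -/
def fullLine (ω : ℤ → Mark) : Config ℤ where
  pos n := ∑ i ∈ Finset.Ioc 0 n, ((ω i).1 : ℝ) - ∑ i ∈ Finset.Ioc n 0, ((ω i).1 : ℝ)
  vel n := (ω n).2.1
  spin n := (ω n).2.2

open Classical in
/-- `N_k`: in the half-line process restricted to its first `k` particles, the number of surviving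
static particles minus the number of surviving left-going particles. -/
def netCount (k : ℕ) (ω : ℕ → Mark) : ℤ :=
  ∑ i ∈ Finset.range k,
    ((if (halfLine ω).vel i = 0 then 1 else 0) - (if (halfLine ω).vel i = -1 then 1 else 0)) *
      (if (halfLine ω).Survives {n | n < k} i then 1 else 0)

/-- `θ(p)`: the probability, in the full-line process, that the particle at the origin survives
forever, given that it is static. -/
def theta (m : Measure (Set.Ioi (0 : ℝ))) (p : ℝ) : ℝ :=
  ((fullLineLaw m p)[|{ω | (fullLine ω).vel 0 = 0}]).real
    {ω | (fullLine ω).Survives Set.univ 0}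

/-! ### The laws above are probability measures -/

theorem isProbabilityMeasure_velocityLaw {p : ℝ} (hp : p ∈ Set.Icc (0 : ℝ) 1) :
    IsProbabilityMeasure (velocityLaw p) := by
  constructor
  have h0 := hp.1
  have h1 : 0 ≤ (1 - p) / 2 := by linarith [hp.2]
  simp only [velocityLaw, Measure.add_apply, Measure.smul_apply, measure_univ, smul_eq_mul, mul_one]
  rw [← ENNReal.ofReal_add h0 h1, ← ENNReal.ofReal_add (by linarith) h1, ← ENNReal.ofReal_one]
  congr 1
  ring

instance isProbabilityMeasure_spinLaw : IsProbabilityMeasure spinLaw := by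
  constructor
  simp [spinLaw, ENNReal.inv_two_add_inv_two]

theorem isProbabilityMeasure_markLaw (m : Measure (Set.Ioi (0 : ℝ))) [IsProbabilityMeasure m]
    {p : ℝ} (hp : p ∈ Set.Icc (0 : ℝ) 1) : IsProbabilityMeasure (markLaw m p) := by
  have := isProbabilityMeasure_velocityLaw hp
  unfold markLaw
  infer_instance

end

end BallisticAnnihilation

namespace BallisticAnnihilation
namespace Config

variable {ι : Type*} {c : Config ι} {S T : Set ι} {i j k l : ι} {t u : ℝ}

/-! ### Kinematics -/

/-! Write "hit" for the event that some left-moving particle of the half-line process reaches the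
origin. A static particle at 0 on the full line is destroyed by a particle from the right only if
the process on its right alone produces a hit, and symmetrically on the left. The two sides are
independent and, up to reflection, have the half-line law, so $\theta>0$ amounts to a positive
probability of no hit (`survives_of_not_hit`, `not_hit_of_survives`).

If $\theta>0$, let $\eta>0$ be the probability that $\bullet_0$ is static and survives. A static
survivor also survives in every window around it, so each of the first $n$ particles is a static
survivor among them with probability at least $\eta$. Left-moving survivors are rare: after each
exit the process restarts independently and has no further exit with probability at least $\eta$, so
their mean number is at most $1/\eta$ (`mul_sum_exit_le`). Hence $\mathbb E[N_n]\ge n\eta-1/\eta$,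
which is positive for large $n$.

Conversely, let $\mathbb E[N_k]>0$. The count is superadditive under concatenation of two blocks,
provided no right-moving particle survives in the first (`netSum_union_le`). If right-moving
particles survive among the first $k$, one waits until the leftmost of them is annihilated; at that
time the count is again $N_k$ and no right-moving particle survives (`exists_split`). Restarting
there bounds the count from below, up to an error $k$, by a random walk with steps distributed as
$N_k$. Exponential tilting then bounds the probability of ever reaching a low level
(`measureReal_ruin_le`). If moreover the first $k$ particles are static, the total count stays
nonnegative, which forbids a hit, since a left-moving survivor in last position forces a negative
count.

The deterministic input is that annihilating pairs are nested (`Annihilate.between`), so that the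
fate of a right-moving particle depends only on what lies on its right, and symmetrically. The spin
rule matters in proving that every collision of live particles is resolved in exactly one way. -/

theorem vel_ne_of_traj_eq (hp : c.pos i ≠ c.pos j) (h : c.traj i t = c.traj j t) :
    c.vel i ≠ c.vel j := by
  intro hv
  simp only [traj, hv] at h
  exact hp (by linarith)

/-- Particles at the same place at the same time have distinct velocities, and there are only three
velocities. -/
theorem not_four (hc : Function.Injective c.pos) (hij : i ≠ j) (hik : i ≠ k) (hil : i ≠ l)
    (hjk : j ≠ k) (hjl : j ≠ l) (hkl : k ≠ l) (h1 : c.traj i t = c.traj j t)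
    (h2 : c.traj i t = c.traj k t) (h3 : c.traj i t = c.traj l t) : False := by
  have a := vel_ne_of_traj_eq (hc.ne hij) h1
  have b := vel_ne_of_traj_eq (hc.ne hik) h2
  have d := vel_ne_of_traj_eq (hc.ne hil) h3
  have e := vel_ne_of_traj_eq (hc.ne hjk) (h1.symm.trans h2)
  have f := vel_ne_of_traj_eq (hc.ne hjl) (h1.symm.trans h3)
  have g := vel_ne_of_traj_eq (hc.ne hkl) (h2.symm.trans h3)
  have key : ∀ x y z w : SignType, x = y ∨ x = z ∨ x = w ∨ y = z ∨ y = w ∨ z = w := by decide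
  rcases key (c.vel i) (c.vel j) (c.vel k) (c.vel l) with h | h | h | h | h | h <;> contradiction

/-- A triple collision has a single static particle, whose spin designates a single velocity, hence
a single spared particle. -/
theorem Spares.not_swap (hc : Function.Injective c.pos) (hij : i ≠ j) (hik : i ≠ k) (hjk : j ≠ k)
    (h1 : c.traj i t = c.traj j t) (h2 : c.traj i t = c.traj k t) (h : c.Spares i j k)
    (h' : c.Spares i k j) : False := by
  have a := vel_ne_of_traj_eq (hc.ne hij) h1
  have b := vel_ne_of_traj_eq (hc.ne hik) h2
  have d := vel_ne_of_traj_eq (hc.ne hjk) (h1.symm.trans h2)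
  revert h h' a b d
  unfold Spares
  generalize c.vel i = x
  generalize c.vel j = y
  generalize c.vel k = z
  generalize c.spin i = r
  generalize c.spin j = s
  generalize c.spin k = q
  revert x y z r s q
  decide

theorem Annihilate.mem_left (h : c.Annihilate S i j t) : i ∈ S := by cases h; assumption
theorem Annihilate.mem_right (h : c.Annihilate S i j t) : j ∈ S := by cases h; assumption
theorem Annihilate.meet (h : c.Annihilate S i j t) : c.Meet i j t := by cases h; assumption

theorem Meet.vel_lt [LinearOrder ι] (hc : StrictMono c.pos) (h : c.Meet i j t) (hij : i < j) :
    (c.vel j : ℝ) < c.vel i := by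
  have h1 := hc hij
  obtain ⟨_, h0, h2⟩ := h
  simp only [traj] at h2
  by_contra! h3
  nlinarith

theorem exists_meet_of_traj_le (hp : c.pos i < c.pos j) (ht : 0 ≤ t)
    (h : c.traj j t ≤ c.traj i t) : ∃ w ≤ t, c.Meet i j w := by
  have hij : i ≠ j := fun h => hp.ne (by rw [h])
  simp only [traj] at h
  have hv : 0 < (c.vel i : ℝ) - c.vel j := by
    by_contra! h3
    nlinarith
  refine ⟨(c.pos j - c.pos i) / (c.vel i - c.vel j), ?_, hij, ?_, ?_⟩
  · rw [div_le_iff₀ hv]; linarith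
  · exact div_nonneg (by linarith) hv.le
  · simp only [traj]
    field_simp
    ring

theorem abs_vel_le (c : Config ι) (i : ι) : |(c.vel i : ℝ)| ≤ 1 := by
  rcases SignType.trichotomy (c.vel i) with h | h | h <;> simp [h]

theorem abs_traj_sub_traj_le (c : Config ι) (i : ι) {s t : ℝ} (h : s ≤ t) :
    |c.traj i s - c.traj i t| ≤ t - s := by
  have h1 : c.traj i s - c.traj i t = c.vel i * (s - t) := by simp only [traj]; ring
  rw [h1, abs_mul, abs_of_nonpos (by linarith : s - t ≤ 0)]
  nlinarith [c.abs_vel_le i]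

/-! ### Uniqueness of annihilations -/

/-- Induction on the first derivation. By the induction hypothesis, a competitor that meets `i` or
`j` by time `t` and is annihilated with one of them has to be the particle spared at time `t`.
Playing the rules of both annihilations against each other then yields either two spared particles
in one triple collision or four particles at one point. -/
theorem Annihilate.unique (hc : Function.Injective c.pos) (h : c.Annihilate S i j t) :
    ∀ {j' t'}, c.Annihilate S i j' t' → j' = j ∧ t' = t := by
  induction h with
  | @intro i j t hi hj hm p τ hne hann ih =>
    have D1 : c.Annihilate S i j t := .intro hi hj hm p τ hne hann
    have hK : ∀ k, k ≠ i → k ≠ j → ∀ u ≤ t, (c.Meet k i u ∨ c.Meet k j u) →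
        (∃ v, c.Annihilate S k i v ∨ c.Annihilate S k j v) → u = t ∧ c.Spares i j k := by
      rintro k hki hkj u hu hmu ⟨v, hv⟩
      by_contra hs
      have hk : k ∈ S := hv.elim (·.mem_left) (·.mem_left)
      obtain ⟨n1, n2, -⟩ := hne k hk hki hkj u hu hmu hs
      rcases hv with hv | hv
      · exact n1 (ih k hk hki hkj u hu hmu hs hv).1.symm
      · exact n2 (ih k hk hki hkj u hu hmu hs hv).1.symm
    intro j' t' D2
    by_cases hjj : j' = j
    · subst hjj
      exact ⟨rfl, (hm.time_unique (hc.ne hm.1) D2.meet).symm⟩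
    exfalso
    have hm2 := D2.meet
    have h2 := ((annihilate_iff hc).1 D2).2.2.2
    have hj'i : j' ≠ i := hm2.1.symm
    rcases le_or_gt t' t with hle | hlt
    · obtain ⟨rfl, hs⟩ := hK j' hj'i hjj t' hle (Or.inl hm2.symm) ⟨t', Or.inl D2.symm⟩
      rcases h2 j hj hm.1.symm (Ne.symm hjj) t' le_rfl (Or.inl hm.symm) with ⟨-, hs'⟩ |
        ⟨b, v, hbi, hbj', hv, D3⟩
      · exact Spares.not_swap hc hm.1 hj'i.symm (Ne.symm hjj) hm.2.2 hm2.2.2 hs hs'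
      · have hbj := D3.meet.1.symm
        obtain ⟨rfl, -⟩ := hK b hbi hbj v hv (Or.inr D3.meet.symm) ⟨v, Or.inr D3.symm⟩
        exact not_four hc hm.1 hj'i.symm hbi.symm (Ne.symm hjj) hbj.symm hbj'.symm hm.2.2 hm2.2.2
          (hm.2.2.trans D3.meet.2.2)
    · rcases h2 j hj hm.1.symm (Ne.symm hjj) t hlt.le (Or.inl hm.symm) with ⟨hh, -⟩ |
        ⟨b, v, hbi, hbj', hv, D3⟩
      · exact hlt.ne hh
      · have hbj := D3.meet.1.symm
        obtain ⟨rfl, hs⟩ := hK b hbi hbj v hv (Or.inr D3.meet.symm) ⟨v, Or.inr D3.symm⟩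
        rcases ((annihilate_iff hc).1 D3).2.2.2 i hi hm.1 hbi.symm v le_rfl (Or.inl hm) with
          ⟨-, hs'⟩ | ⟨e, w, hej, heb, hw, D4⟩
        · exact Spares.not_swap hc hm.1.symm hbj.symm hbi.symm hm.2.2.symm D3.meet.2.2 hs.symm hs'
        · have hei := D4.meet.1.symm
          obtain ⟨rfl, -⟩ := hK e hei hej w hw (Or.inl D4.meet.symm) ⟨w, Or.inl D4.symm⟩
          exact not_four hc hm.1 hbi.symm hei.symm hbj.symm hej.symm heb.symm hm.2.2
            (hm.2.2.trans D3.meet.2.2) D4.meet.2.2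

/-! ### Existence of annihilations -/

/-- Only finitely many of the particles in `S` start from any given bounded interval. -/
def LocallyFinite (c : Config ι) (S : Set ι) : Prop :=
  ∀ x r : ℝ, {i ∈ S | |c.pos i - x| ≤ r}.Finite

theorem LocallyFinite.mono (h : c.LocallyFinite S) (hT : T ⊆ S) : c.LocallyFinite T :=
  fun x r => (h x r).subset fun _ hi => ⟨hT hi.1, hi.2⟩

theorem locallyFinite_of_finite (h : S.Finite) : c.LocallyFinite S :=
  fun _ _ => h.subset fun _ hi => hi.1

theorem exists_spin_eq (x y z : SignType) (r s q : ℤˣ) (h1 : x ≠ y) (h2 : x ≠ z) (h3 : y ≠ z) :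
    (x = 0 ∧ (y : ℤ) = r) ∨ (x = 0 ∧ (z : ℤ) = r) ∨ (y = 0 ∧ (x : ℤ) = s) ∨
    (y = 0 ∧ (z : ℤ) = s) ∨ (z = 0 ∧ (x : ℤ) = q) ∨ (z = 0 ∧ (y : ℤ) = q) := by
  revert x y z r s q
  decide

/-- If neither particle were annihilated by time `t`, take the earliest such unresolved collision in
the backward light cone of the meeting point. It exists because, by local finiteness, only finitely
many particles start in the base of the cone. There, the rule can only be obstructed by a third live
particle at the same place, and then the spin singles out a pair for which the rule does hold. -/
theorem exists_annihilate_of_meet (hc : Function.Injective c.pos) (hS : c.LocallyFinite S)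
    (hi : i ∈ S) (hj : j ∈ S) (hm : c.Meet i j t) :
    ∃ k, ∃ v ≤ t, c.Annihilate S i k v ∨ c.Annihilate S j k v := by
  by_contra hno
  set x := c.traj i t with hx
  set U : Set ℝ := {u | ∃ a ∈ S, ∃ b ∈ S, c.Meet a b u ∧ |c.traj a u - x| ≤ t - u ∧
    ∀ k, ∀ v ≤ u, ¬ c.Annihilate S a k v ∧ ¬ c.Annihilate S b k v} with hU
  have htU : t ∈ U := ⟨i, hi, j, hj, hm, by simp [hx], fun k v hv =>
    ⟨fun h => hno ⟨k, v, hv, Or.inl h⟩, fun h => hno ⟨k, v, hv, Or.inr h⟩⟩⟩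
  have hcone : ∀ a u, 0 ≤ u → |c.traj a u - x| ≤ t - u → |c.pos a - x| ≤ t := by
    intro a u hu h
    have h1 := c.abs_traj_sub_traj_le a hu
    have h2 : c.traj a 0 = c.pos a := by simp [traj]
    rw [h2] at h1
    have := abs_sub_le (c.pos a) (c.traj a u) x
    linarith
  have hfin : U.Finite := by
    have hW := hS x t
    refine ((hW.prod hW).image
      fun q : ι × ι => (c.pos q.2 - c.pos q.1) / (c.vel q.1 - c.vel q.2 : ℝ)).subset ?_
    rintro u ⟨a, ha, b, hb, hab, hau, -⟩
    refine ⟨(a, b), ⟨⟨ha, hcone a u hab.2.1 hau⟩, hb, hcone b u hab.2.1 (hab.2.2 ▸ hau)⟩, ?_⟩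
    have hv := vel_ne_of_traj_eq (hc.ne hab.1) hab.2.2
    have h3 := hab.2.2
    simp only [traj] at h3
    have hv' : (c.vel a : ℝ) - c.vel b ≠ 0 := by
      intro h0
      have : (c.vel a : ℝ) = c.vel b := by linarith
      rw [this] at h3
      exact hc.ne hab.1 (by linarith)
    show (c.pos b - c.pos a) / (c.vel a - c.vel b : ℝ) = u
    rw [div_eq_iff hv']
    linarith
  obtain ⟨u, ⟨a, ha, b, hb, hab, hau, halive⟩, hmin⟩ := Set.exists_min_image U id hfin ⟨t, htU⟩
  simp only [id] at hmin
  -- the particles alive at the earliest unresolved collision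
  have hstep : ∀ a ∈ S, ∀ k ∈ S, |c.traj a u - x| ≤ t - u →
      (∀ n, ∀ v ≤ u, ¬ c.Annihilate S a n v) → ∀ w ≤ u, c.Meet k a w →
      (∀ n, ∀ v ≤ w, ¬ c.Annihilate S k n v) → w = u := by
    intro a ha k hk hau hal w hw hka hkal
    refine le_antisymm hw (hmin w ⟨k, hk, a, ha, hka, ?_, fun n v hv =>
      ⟨hkal n v hv, hal n v (hv.trans hw)⟩⟩)
    have h1 := c.abs_traj_sub_traj_le a hw
    have h2 := abs_sub_le (c.traj a w) (c.traj a u) x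
    rw [hka.2.2]
    linarith
  -- two alive particles annihilate unless a third one which is not spared is alive there
  have hpair : ∀ a ∈ S, ∀ b ∈ S, c.Meet a b u → |c.traj a u - x| ≤ t - u →
      (∀ n, ∀ v ≤ u, ¬ c.Annihilate S a n v) → (∀ n, ∀ v ≤ u, ¬ c.Annihilate S b n v) →
      ∃ k ∈ S, k ≠ a ∧ k ≠ b ∧ c.traj a u = c.traj k u ∧ ¬ c.Spares a b k ∧
        ∀ n, ∀ v ≤ u, ¬ c.Annihilate S k n v := by
    intro a ha b hb hab hau hala halb
    by_contra hcon
    refine hala b u le_rfl ((annihilate_iff hc).2 ⟨ha, hb, hab, ?_⟩)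
    intro k hk hka hkb w hw hkm
    by_cases hkal : ∀ n, ∀ v ≤ w, ¬ c.Annihilate S k n v
    · have hwu : w = u := by
        rcases hkm with h | h
        · exact hstep a ha k hk hau hala w hw h hkal
        · exact hstep b hb k hk (hab.2.2 ▸ hau) halb w hw h hkal
      subst hwu
      refine Or.inl ⟨rfl, ?_⟩
      by_contra hsp
      refine hcon ⟨k, hk, hka, hkb, ?_, hsp, hkal⟩
      rcases hkm with h | h
      · exact h.2.2.symm
      · exact hab.2.2.trans h.2.2.symm
    · push Not at hkal
      obtain ⟨n, v, hv, hA⟩ := hkal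
      refine Or.inr ⟨n, v, ?_, ?_, hv, hA⟩
      · rintro rfl; exact hala k v (hv.trans hw) hA.symm
      · rintro rfl; exact halb k v (hv.trans hw) hA.symm
  obtain ⟨k, hk, hka, hkb, hak, -, hkal⟩ := hpair a ha b hb hab hau
    (fun n v hv => (halive n v hv).1) (fun n v hv => (halive n v hv).2)
  have htriple : ∀ z ∈ S, ∀ y ∈ S, ∀ w ∈ S, z ≠ y → z ≠ w → y ≠ w →
      c.traj z u = c.traj y u → c.traj z u = c.traj w u → |c.traj z u - x| ≤ t - u →
      (∀ n, ∀ v ≤ u, ¬ c.Annihilate S z n v) → (∀ n, ∀ v ≤ u, ¬ c.Annihilate S y n v) →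
      ¬ (c.vel z = 0 ∧ (c.vel w : ℤ) = c.spin z) := by
    intro z hz y hy w _ hzy hzw hyw h1 h2 hcz hzal hyal hsp
    obtain ⟨k', hk', hkz, hky, hzk, hns, -⟩ :=
      hpair z hz y hy ⟨hzy, hab.2.1, h1⟩ hcz hzal hyal
    by_cases hkw : k' = w
    · subst hkw; exact hns (Or.inl hsp)
    · exact not_four hc hzy hzw hkz.symm hyw (Ne.symm hky) (Ne.symm hkw) h1 h2 hzk
  have hala := fun n v hv => (halive n v hv).1
  have halb := fun n v hv => (halive n v hv).2
  have hab' := hab.2.2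
  have hau_b : |c.traj b u - x| ≤ t - u := hab' ▸ hau
  have hau_k : |c.traj k u - x| ≤ t - u := hak ▸ hau
  rcases exists_spin_eq (c.vel a) (c.vel b) (c.vel k) (c.spin a) (c.spin b) (c.spin k)
    (vel_ne_of_traj_eq (hc.ne hab.1) hab') (vel_ne_of_traj_eq (hc.ne hka.symm) hak)
    (vel_ne_of_traj_eq (hc.ne hkb.symm) (hab'.symm.trans hak)) with h | h | h | h | h | h
  · exact htriple a ha k hk b hb hka.symm hab.1 hkb hak hab' hau hala hkal h
  · exact htriple a ha b hb k hk hab.1 hka.symm hkb.symm hab' hak hau hala halb h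
  · exact htriple b hb k hk a ha hkb.symm hab.1.symm hka (hab'.symm.trans hak) hab'.symm hau_b
      halb hkal h
  · exact htriple b hb a ha k hk hab.1.symm hkb.symm hka.symm hab'.symm (hab'.symm.trans hak) hau_b
      halb hala h
  · exact htriple k hk b hb a ha hkb hka hab.1.symm (hak.symm.trans hab') hak.symm hau_k
      hkal halb h
  · exact htriple k hk a ha b hb hka hkb hab.1 hak.symm (hak.symm.trans hab') hau_k
      hkal hala h

/-! ### Restriction to a subset of the particles -/

/-- The derivation is replayed in `T`: it has fewer particles to account for, and by `hcross` the
partners invoked for those of `T` are still present. -/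
theorem Annihilate.restrict (hc : Function.Injective c.pos) (hTS : T ⊆ S) {t₀ : ℝ}
    (hcross : ∀ a ∈ T, ∀ b, ∀ u ≤ t₀, c.Annihilate S a b u → b ∈ T)
    (h : c.Annihilate S i j t) : i ∈ T → j ∈ T → t ≤ t₀ → c.Annihilate T i j t := by
  induction h with
  | @intro i j t hi hj hm p τ hne hann ih =>
    intro hiT hjT ht
    rw [annihilate_iff hc]
    refine ⟨hiT, hjT, hm, fun k hk hki hkj u hu hmu => ?_⟩
    by_cases hs : u = t ∧ c.Spares i j k
    · exact Or.inl hs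
    · obtain ⟨a, b, d⟩ := hne k (hTS hk) hki hkj u hu hmu hs
      have hle : τ k ≤ t₀ := by linarith
      exact Or.inr ⟨_, _, a, b, d, ih k (hTS hk) hki hkj u hu hmu hs hk
        (hcross k hk _ _ hle (hann k (hTS hk) hki hkj u hu hmu hs)) hle⟩

/-- Particles `i` and `j` annihilate each other in the process restricted to `S`. -/
def Match (c : Config ι) (S : Set ι) (i j : ι) : Prop := ∃ t, c.Annihilate S i j t

theorem Match.symm (h : c.Match S i j) : c.Match S j i := h.imp fun _ => Annihilate.symm
theorem Match.mem_left (h : c.Match S i j) : i ∈ S := h.elim fun _ => Annihilate.mem_left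
theorem Match.mem_right (h : c.Match S i j) : j ∈ S := h.elim fun _ => Annihilate.mem_right

theorem Match.unique (hc : Function.Injective c.pos) (h : c.Match S i j) (h' : c.Match S i k) :
    k = j := by
  obtain ⟨t, h⟩ := h
  obtain ⟨u, h'⟩ := h'
  exact (h.unique hc h').1

theorem Match.ne (h : c.Match S i j) : i ≠ j := by
  obtain ⟨t, h⟩ := h
  exact h.meet.1

theorem survives_iff : c.Survives S i ↔ i ∈ S ∧ ∀ j, ¬ c.Match S i j := by
  simp only [Survives, Match, not_exists]

theorem exists_match (hi : i ∈ S) (h : ¬ c.Survives S i) : ∃ j, c.Match S i j := by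
  rw [survives_iff] at h
  push Not at h
  exact h hi

theorem Survives.not_match (h : c.Survives S i) : ¬ c.Match S i j := (survives_iff.1 h).2 j

/-- `T` is a union of annihilated pairs and of surviving particles. -/
def Closed (c : Config ι) (S T : Set ι) : Prop :=
  T ⊆ S ∧ ∀ a ∈ T, ∀ b, c.Match S a b → b ∈ T

/-- A pair of `S` restricts to `T`. Conversely a pair of `T` meets, so one of its members is
annihilated in `S`; that annihilation restricts to `T`, and uniqueness there identifies the partner.
-/
theorem Closed.match_iff (hc : Function.Injective c.pos) (hS : c.LocallyFinite S)
    (h : c.Closed S T) (hi : i ∈ T) : c.Match T i j ↔ c.Match S i j := by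
  have key : ∀ {a b}, a ∈ T → c.Match S a b → c.Match T a b := by
    rintro a b ha ⟨t, hab⟩
    exact ⟨t, hab.restrict hc h.1 (fun x hx y u _ hxy => h.2 x hx y ⟨u, hxy⟩) ha
      (h.2 a ha b ⟨t, hab⟩) le_rfl⟩
  refine ⟨?_, key hi⟩
  rintro ⟨t, hij⟩
  obtain ⟨k, v, -, hA⟩ := exists_annihilate_of_meet hc hS (h.1 hij.mem_left) (h.1 hij.mem_right)
    hij.meet
  rcases hA with hA | hA
  · have h1 : c.Match S i k := ⟨v, hA⟩
    rwa [← Match.unique hc ⟨t, hij⟩ (key hi h1)]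
  · have h1 : c.Match S j k := ⟨v, hA⟩
    have h2 : c.Match T j i := ⟨t, hij.symm⟩
    rw [Match.unique hc h2 (key hij.mem_right h1)] at h1
    exact h1.symm

theorem Closed.match_of_match (hc : Function.Injective c.pos)
    (h : c.Closed S T) (hi : i ∈ T) (hm : c.Match S i j) : c.Match T i j := by
  obtain ⟨t, hab⟩ := hm
  exact ⟨t, hab.restrict hc h.1 (fun x hx y u _ hxy => h.2 x hx y ⟨u, hxy⟩) hi
      (h.2 i hi j ⟨t, hab⟩) le_rfl⟩

theorem Closed.survives_iff (hc : Function.Injective c.pos) (hS : c.LocallyFinite S)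
    (h : c.Closed S T) (hi : i ∈ T) : c.Survives T i ↔ c.Survives S i := by
  simp only [Config.survives_iff, h.match_iff hc hS hi, hi, h.1 hi]

theorem Closed.diff (h : c.Closed S T) : c.Closed S (S \ T) :=
  ⟨Set.sdiff_subset, fun _ ha _ hab => ⟨hab.mem_right, fun hb => ha.2 (h.2 _ hb _ hab.symm)⟩⟩

end Config
end BallisticAnnihilation

namespace BallisticAnnihilation
namespace Config

variable {ι : Type*} [LinearOrder ι] {c : Config ι} {S T : Set ι} {i j k l : ι} {t u : ℝ}

/-! ### Annihilating pairs are nested -/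

/-- A particle starting between `i` and `j` has to meet one of them before they meet. -/
theorem exists_first_meet (hc : StrictMono c.pos) (hm : c.Meet i j t) (hik : i < k) (hkj : k < j) :
    ∃ u ≤ t, (c.Meet k i u ∨ c.Meet k j u) ∧
      ∀ s, 0 ≤ s → s ≤ u → c.traj i s ≤ c.traj k s ∧ c.traj k s ≤ c.traj j s := by
  have hp1 := hc hik
  have hp2 := hc hkj
  have ht := hm.2.1
  have key : ∀ {a b : ι} {w : ℝ}, c.pos a < c.pos b → c.Meet a b w → ∀ s, 0 ≤ s → s ≤ w →
      c.traj a s ≤ c.traj b s := by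
    intro a b w hab h s hs hsw
    by_contra! hlt
    obtain ⟨v, hv, hmv⟩ := exists_meet_of_traj_le hab hs hlt.le
    have := hmv.time_unique hab.ne h
    have hsw' : s = w := by linarith
    subst hsw'
    exact absurd h.2.2 hlt.ne'
  rcases le_total (c.traj k t) (c.traj i t) with h1 | h1
  · obtain ⟨u, hu, hmu⟩ := exists_meet_of_traj_le hp1 ht h1
    by_cases h2 : c.traj j u ≤ c.traj k u
    · obtain ⟨v, hv, hmv⟩ := exists_meet_of_traj_le hp2 hmu.2.1 h2
      exact ⟨v, hv.trans hu, Or.inr hmv, fun s hs hsv =>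
        ⟨key hp1 hmu s hs (hsv.trans hv), key hp2 hmv s hs hsv⟩⟩
    · refine ⟨u, hu, Or.inl hmu.symm, fun s hs hsu => ⟨key hp1 hmu s hs hsu, ?_⟩⟩
      by_contra! h3
      obtain ⟨v, hv, hmv⟩ := exists_meet_of_traj_le hp2 hs h3.le
      -- after `v`, particle `k` stays ahead of `j`
      have hvel := hmv.vel_lt hc hkj
      have h4 := hmv.2.2
      simp only [traj, not_le] at h4 h2
      nlinarith
  · have h1' : c.traj j t ≤ c.traj k t := hm.2.2 ▸ h1
    obtain ⟨u, hu, hmu⟩ := exists_meet_of_traj_le hp2 ht h1'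
    by_cases h2 : c.traj k u ≤ c.traj i u
    · obtain ⟨v, hv, hmv⟩ := exists_meet_of_traj_le hp1 hmu.2.1 h2
      exact ⟨v, hv.trans hu, Or.inl hmv.symm, fun s hs hsv =>
        ⟨key hp1 hmv s hs hsv, key hp2 hmu s hs (hsv.trans hv)⟩⟩
    · refine ⟨u, hu, Or.inr hmu, fun s hs hsu => ⟨?_, key hp2 hmu s hs hsu⟩⟩
      by_contra! h3
      obtain ⟨v, hv, hmv⟩ := exists_meet_of_traj_le hp1 hs h3.le
      have hvel := hmv.vel_lt hc hik
      have h4 := hmv.2.2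
      simp only [traj, not_le] at h4 h2
      nlinarith

/-- In a triple collision, the middle particle is static, hence it is not spared. -/
theorem not_spares_of_between (hc : StrictMono c.pos) (hik : i < k) (hkj : k < j)
    (h1 : c.Meet i k t) (h2 : c.Meet k j t) : ¬ c.Spares i j k := by
  have a := h1.vel_lt hc hik
  have b := h2.vel_lt hc hkj
  unfold Spares
  rcases SignType.trichotomy (c.vel i) with hi | hi | hi <;>
  rcases SignType.trichotomy (c.vel k) with hk | hk | hk <;>
  rcases SignType.trichotomy (c.vel j) with hj | hj | hj <;>
  simp [hi, hk, hj] at a b ⊢ <;> linarith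

/-- Squeezed between `i` and `j`, particle `k` meets one of them by time `t`; being in the middle it
cannot be spared, so it has been annihilated with some `k'`. Were `k'` to start outside, it would
have to cross `i` or `j` no later than it reaches `k`. The rule for `i`, `j` forces this crossing to
be a triple collision with `k`, whose middle particle is `i` or `j`: that one is not spared either,
and would be annihilated before time `t`. -/
theorem Annihilate.between (hc : StrictMono c.pos) (h : c.Annihilate S i j t) (hk : k ∈ S)
    (hik : i < k) (hkj : k < j) :
    ∃ k', i < k' ∧ k' < j ∧ ∃ u < t, c.Annihilate S k k' u := by
  have hinj := hc.injective
  have hm := h.meet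
  have hrule := ((annihilate_iff hinj).1 h).2.2.2
  obtain ⟨u, hut, hmu, hord⟩ := exists_first_meet hc hm hik hkj
  rcases hrule k hk hik.ne' hkj.ne u hut hmu with ⟨rfl, hsp⟩ | ⟨k', u', hk'i, hk'j, hu', hA⟩
  · exfalso
    have h1 : c.traj k u = c.traj i u := hmu.elim (·.2.2) fun h => h.2.2.trans hm.2.2.symm
    exact not_spares_of_between hc hik hkj ⟨hik.ne, hm.2.1, h1.symm⟩
      ⟨hkj.ne, hm.2.1, h1.trans hm.2.2⟩ hsp
  have hkk' := hA.meet.1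
  have hlt : u' < t := by
    refine lt_of_le_of_ne (hu'.trans hut) ?_
    rintro rfl
    obtain rfl : u = u' := le_antisymm hut hu'
    have h1 : c.traj k u = c.traj i u := hmu.elim (·.2.2) fun h => h.2.2.trans hm.2.2.symm
    exact not_four hinj hik.ne hm.1 hk'i.symm hkj.ne hkk' hk'j.symm h1.symm hm.2.2
      (h1.symm.trans hA.meet.2.2)
  have hord' := hord u' hA.meet.2.1 hu'
  refine ⟨k', ?_, ?_, u', hlt, hA⟩
  · by_contra! hle
    have hk'lt : k' < i := lt_of_le_of_ne hle hk'i
    obtain ⟨w, hw, hmw⟩ := exists_meet_of_traj_le (hc hk'lt) hA.meet.2.1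
      (hord'.1.trans_eq hA.meet.2.2)
    rcases hrule k' hA.mem_right hk'i hk'j w (by linarith) (Or.inl hmw) with ⟨rfl, -⟩ |
      ⟨a, v, hai, -, hv, hA'⟩
    · linarith
    obtain ⟨rfl, rfl⟩ := hA.symm.unique hinj hA'
    obtain rfl : v = w := le_antisymm hv hw
    have hki : c.Meet i a v := ⟨hik.ne, hmw.2.1, hmw.2.2.symm.trans hA.meet.2.2.symm⟩
    rcases ((annihilate_iff hinj).1 hA').2.2.2 i h.mem_left hk'i.symm hik.ne v le_rfl
      (Or.inr hki) with ⟨-, hsp⟩ | ⟨e, s, hek, -, hs, hA3⟩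
    · exact not_spares_of_between hc hk'lt hik hmw hki hsp
    · obtain ⟨-, rfl⟩ := h.unique hinj hA3
      linarith
  · by_contra! hle
    have hk'lt : j < k' := lt_of_le_of_ne hle hk'j.symm
    obtain ⟨w, hw, hmw⟩ := exists_meet_of_traj_le (hc hk'lt) hA.meet.2.1
      (hA.meet.2.2.symm.trans_le hord'.2)
    rcases hrule k' hA.mem_right hk'i hk'j w (by linarith) (Or.inr hmw.symm) with ⟨rfl, -⟩ |
      ⟨a, v, hai, -, hv, hA'⟩
    · linarith
    obtain ⟨rfl, rfl⟩ := hA.symm.unique hinj hA'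
    obtain rfl : v = w := le_antisymm hv hw
    have hki : c.Meet a j v := ⟨hkj.ne, hmw.2.1, hA.meet.2.2.trans hmw.2.2.symm⟩
    rcases ((annihilate_iff hinj).1 hA'.symm).2.2.2 j h.mem_right hkj.ne' hk'j.symm v le_rfl
      (Or.inl hki.symm) with ⟨-, hsp⟩ | ⟨e, s, hek, -, hs, hA3⟩
    · exact not_spares_of_between hc hkj hk'lt hki hmw hsp
    · obtain ⟨-, rfl⟩ := h.symm.unique hinj hA3
      linarith

theorem Match.vel_lt (hc : StrictMono c.pos) (h : c.Match S i j) (hij : i < j) :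
    (c.vel j : ℝ) < c.vel i := by
  obtain ⟨t, h⟩ := h
  exact h.meet.vel_lt hc hij

theorem Match.lt_of_vel_eq_one (hc : StrictMono c.pos) (h : c.Match S i j) (hi : c.vel i = 1) :
    i < j := by
  by_contra! hle
  have := h.symm.vel_lt hc (lt_of_le_of_ne hle h.ne.symm)
  have h2 := c.abs_vel_le j
  rw [hi] at this
  simp at this
  linarith [le_abs_self (c.vel j : ℝ)]

theorem Match.vel_ne (hc : StrictMono c.pos) (h : c.Match S i j) : c.vel i ≠ c.vel j := by
  obtain ⟨t, h⟩ := h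
  exact vel_ne_of_traj_eq (hc.injective.ne h.meet.1) h.meet.2.2

theorem Match.between (hc : StrictMono c.pos) (h : c.Match S i j) (hk : k ∈ S)
    (hik : i < k) (hkj : k < j) : ∃ k', i < k' ∧ k' < j ∧ c.Match S k k' := by
  obtain ⟨t, h⟩ := h
  obtain ⟨k', h1, h2, u, -, h3⟩ := h.between hc hk hik hkj
  exact ⟨k', h1, h2, u, h3⟩

theorem Match.closed_Icc (hc : StrictMono c.pos) (h : c.Match S i j) (hij : i < j) :
    c.Closed S (S ∩ Set.Icc i j) := by
  refine ⟨Set.inter_subset_left, fun a ha b hab => ⟨hab.mem_right, ?_⟩⟩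
  rcases eq_or_lt_of_le ha.2.1 with rfl | h1
  · rw [h.unique hc.injective hab]; exact ⟨hij.le, le_rfl⟩
  rcases eq_or_lt_of_le ha.2.2 with rfl | h2
  · rw [h.symm.unique hc.injective hab]; exact ⟨le_rfl, hij.le⟩
  obtain ⟨k', h3, h4, h5⟩ := h.between hc ha.1 h1 h2
  rw [h5.unique hc.injective hab]
  exact ⟨h3.le, h4.le⟩

/-- By nestedness, a pair straddling a particle would annihilate it: a survivor separates the system
into two independent pieces. -/
theorem Survives.closed_Iio (hc : StrictMono c.pos) (h : c.Survives S i) :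
    c.Closed S (S ∩ Set.Iio i) := by
  refine ⟨Set.inter_subset_left, fun a ha b hab => ⟨hab.mem_right, ?_⟩⟩
  show b < i
  by_contra! hb
  rcases eq_or_lt_of_le hb with rfl | hb
  · exact h.not_match hab.symm
  · obtain ⟨k', -, -, h5⟩ := hab.between hc h.1 ha.2 hb
    exact h.not_match h5

theorem Survives.closed_Ioi (hc : StrictMono c.pos) (h : c.Survives S i) :
    c.Closed S (S ∩ Set.Ioi i) := by
  refine ⟨Set.inter_subset_left, fun a ha b hab => ⟨hab.mem_right, ?_⟩⟩
  show i < b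
  by_contra! hb
  rcases eq_or_lt_of_le hb with rfl | hb
  · exact h.not_match hab.symm
  · obtain ⟨k', -, -, h5⟩ := hab.symm.between hc h.1 hb ha.2
    exact h.not_match h5

theorem Survives.closed_Ici (hc : StrictMono c.pos) (h : c.Survives S i) :
    c.Closed S (S ∩ Set.Ici i) := by
  convert (h.closed_Iio hc).diff using 1
  ext x; simp only [Set.mem_inter_iff, Set.mem_Ici, Set.mem_sdiff, Set.mem_Iio, not_and, not_lt]
  tauto

theorem Survives.closed_Iic (hc : StrictMono c.pos) (h : c.Survives S i) :
    c.Closed S (S ∩ Set.Iic i) := by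
  convert (h.closed_Ioi hc).diff using 1
  ext x; simp only [Set.mem_inter_iff, Set.mem_Iic, Set.mem_sdiff, Set.mem_Ioi, not_and, not_lt]
  tauto

/-- The fate of a right-moving particle only depends on the particles on its right. -/
theorem match_Ici_iff (hc : StrictMono c.pos) (hS : c.LocallyFinite S) (hi : c.vel i = 1) :
    c.Match (S ∩ Set.Ici i) i j ↔ c.Match S i j := by
  have key : ∀ {j}, c.Match S i j → c.Match (S ∩ Set.Ici i) i j := by
    rintro j ⟨t, h⟩
    have hij := Match.lt_of_vel_eq_one hc ⟨t, h⟩ hi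
    refine ⟨t, h.restrict hc.injective Set.inter_subset_left (t₀ := t) ?_ ⟨h.mem_left, le_rfl⟩
      ⟨h.mem_right, hij.le⟩ le_rfl⟩
    intro a ha b u hu hab
    refine ⟨hab.mem_right, ?_⟩
    show i ≤ b
    by_contra! hb
    rcases eq_or_lt_of_le (show i ≤ a from ha.2) with rfl | hia
    · exact hb.not_gt (Match.lt_of_vel_eq_one hc ⟨u, hab⟩ hi)
    -- A pair straddling `i` forces the annihilation of `i` strictly before its own, too early to be
    -- the one at time `t`.
    · obtain ⟨k', -, -, v, hv, h5⟩ := hab.symm.between hc h.mem_left hb hia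
      obtain ⟨-, rfl⟩ := h.unique hc.injective h5
      linarith
  refine ⟨fun h => ?_, key⟩
  by_cases hs : c.Survives S i
  · exact ((hs.closed_Ici hc).match_iff hc.injective hS ⟨hs.1, le_rfl⟩).1 h
  · obtain ⟨k, hk⟩ := exists_match h.mem_left.1 hs
    rwa [← (key hk).unique hc.injective h] at hk

end Config
end BallisticAnnihilation

namespace BallisticAnnihilation
namespace Config

/-! ### Isometries -/

section Similar

variable {ι κ : Type*} {c : Config ι} {c' : Config κ} {S : Set ι} {e : ι → κ} {i j k : ι}
  {t : ℝ}

/-- On `S`, up to the relabelling `e`, configuration `c'` is the image of `c` under the isometry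
`x ↦ a + ε x` of the line. -/
structure Similar (c : Config ι) (c' : Config κ) (S : Set ι) (e : ι → κ) (a : ℝ) (ε : ℤˣ) :
    Prop where
  injective : Function.Injective e
  pos : ∀ i ∈ S, c'.pos (e i) = a + ((ε : ℤ) : ℝ) * c.pos i
  vel : ∀ i ∈ S, (c'.vel (e i) : ℤ) = ε * (c.vel i : ℤ)
  spin : ∀ i ∈ S, c'.spin (e i) = ε * c.spin i

namespace Similar

variable {a : ℝ} {ε : ℤˣ}

theorem cast_vel (v : SignType) : ((v : ℤ) : ℝ) = (v : ℝ) := by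
  rcases SignType.trichotomy v with h | h | h <;> simp [h]

theorem traj (h : c.Similar c' S e a ε) (hi : i ∈ S) (t : ℝ) :
    c'.traj (e i) t = a + ((ε : ℤ) : ℝ) * c.traj i t := by
  simp only [Config.traj, h.pos i hi, ← cast_vel, h.vel i hi]
  push_cast
  ring

theorem meet_iff (h : c.Similar c' S e a ε) (hi : i ∈ S) (hj : j ∈ S) :
    c'.Meet (e i) (e j) t ↔ c.Meet i j t := by
  simp only [Meet, h.traj hi, h.traj hj, h.injective.ne_iff]
  have : ((ε : ℤ) : ℝ) ≠ 0 := by exact_mod_cast ε.ne_zero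
  simp [this]

theorem vel_eq_zero_iff (h : c.Similar c' S e a ε) (hi : i ∈ S) :
    c'.vel (e i) = 0 ↔ c.vel i = 0 := by
  have h1 := h.vel i hi
  have h2 : ∀ (x y : SignType) (ε : ℤˣ), (x : ℤ) = ε * (y : ℤ) → (x = 0 ↔ y = 0) := by decide
  exact h2 _ _ _ h1

theorem vel_eq_spin_iff (h : c.Similar c' S e a ε) (hi : i ∈ S) (hj : j ∈ S) :
    (c'.vel (e i) : ℤ) = c'.spin (e j) ↔ (c.vel i : ℤ) = c.spin j := by
  have h1 := h.vel i hi
  rw [h.vel i hi, h.spin j hj, Units.val_mul, mul_right_inj' ε.ne_zero]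

theorem spares_iff (h : c.Similar c' S e a ε) (hi : i ∈ S) (hj : j ∈ S) (hk : k ∈ S) :
    c'.Spares (e i) (e j) (e k) ↔ c.Spares i j k := by
  simp only [Spares, h.vel_eq_zero_iff hi, h.vel_eq_zero_iff hj, h.vel_eq_spin_iff hk hi,
    h.vel_eq_spin_iff hk hj]

theorem annihilate_image (h : c.Similar c' S e a ε) (hc' : Function.Injective c'.pos)
    (hA : c.Annihilate S i j t) : c'.Annihilate (e '' S) (e i) (e j) t := by
  induction hA with
  | @intro i j t hi hj hm p τ hne hann ih =>
    rw [Config.annihilate_iff hc']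
    refine ⟨⟨i, hi, rfl⟩, ⟨j, hj, rfl⟩, (h.meet_iff hi hj).2 hm, ?_⟩
    rintro _ ⟨k, hk, rfl⟩ hki hkj u hu hmu
    rw [h.meet_iff hk hi, h.meet_iff hk hj] at hmu
    rw [h.injective.ne_iff] at hki hkj
    rw [h.spares_iff hi hj hk]
    by_cases hs : u = t ∧ c.Spares i j k
    · exact Or.inl hs
    · obtain ⟨x, y, z⟩ := hne k hk hki hkj u hu hmu hs
      exact Or.inr ⟨e (p k), τ k, h.injective.ne x, h.injective.ne y, z,
        ih k hk hki hkj u hu hmu hs⟩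

theorem annihilate_of_image (h : c.Similar c' S e a ε) (hc : Function.Injective c.pos) {x y : κ}
    (hA : c'.Annihilate (e '' S) x y t) : ∀ i j, x = e i → y = e j → c.Annihilate S i j t := by
  induction hA with
  | @intro x y t hx hy hm p τ hne hann ih =>
    rintro i j rfl rfl
    have hi := h.injective.mem_set_image.1 hx
    have hj := h.injective.mem_set_image.1 hy
    rw [Config.annihilate_iff hc]
    refine ⟨hi, hj, (h.meet_iff hi hj).1 hm, ?_⟩
    intro k hk hki hkj u hu hmu
    rw [← h.meet_iff hk hi, ← h.meet_iff hk hj] at hmu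
    rw [← h.injective.ne_iff] at hki hkj
    rw [← h.spares_iff hi hj hk]
    have hk' : e k ∈ e '' S := ⟨k, hk, rfl⟩
    by_cases hs : u = t ∧ c'.Spares (e i) (e j) (e k)
    · exact Or.inl hs
    · obtain ⟨x, y, z⟩ := hne (e k) hk' hki hkj u hu hmu hs
      obtain ⟨k', -, hkk'⟩ := (hann (e k) hk' hki hkj u hu hmu hs).mem_right
      exact Or.inr ⟨k', τ (e k), fun hh => x (by rw [← hh, hkk']), fun hh => y (by rw [← hh, hkk']),
        z, ih (e k) hk' hki hkj u hu hmu hs k k' rfl hkk'.symm⟩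

theorem annihilate_iff (h : c.Similar c' S e a ε) (hc : Function.Injective c.pos)
    (hc' : Function.Injective c'.pos) :
    c'.Annihilate (e '' S) (e i) (e j) t ↔ c.Annihilate S i j t :=
  ⟨fun hA => h.annihilate_of_image hc hA i j rfl rfl, h.annihilate_image hc'⟩

theorem match_iff (h : c.Similar c' S e a ε) (hc : Function.Injective c.pos)
    (hc' : Function.Injective c'.pos) :
    c'.Match (e '' S) (e i) (e j) ↔ c.Match S i j := by
  simp only [Match, h.annihilate_iff hc hc']

theorem survives_iff (h : c.Similar c' S e a ε) (hc : Function.Injective c.pos)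
    (hc' : Function.Injective c'.pos) :
    c'.Survives (e '' S) (e i) ↔ c.Survives S i := by
  rw [Config.survives_iff, Config.survives_iff, h.injective.mem_set_image]
  refine and_congr_right fun _ => ⟨fun H j hj => H (e j) ((h.match_iff hc hc').2 hj), ?_⟩
  intro H y hy
  obtain ⟨j, -, rfl⟩ := hy.mem_right
  exact H j ((h.match_iff hc hc').1 hy)

end Similar

theorem vel_cases (c : Config ι) (i : ι) : c.vel i = -1 ∨ c.vel i = 0 ∨ c.vel i = 1 :=
  SignType.trichotomy _

/-- Two surviving particles do not meet. -/
theorem Survives.not_meet (hc : Function.Injective c.pos) (hS : c.LocallyFinite S)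
    (hi : c.Survives S i) (hj : c.Survives S j) : ¬ c.Meet i j t := by
  intro hm
  obtain ⟨k, v, -, h | h⟩ := exists_annihilate_of_meet hc hS hi.1 hj.1 hm
  · exact hi.2 _ _ h
  · exact hj.2 _ _ h

/-- The mirror image of a configuration. -/
def mirror (c : Config ι) : Config ιᵒᵈ where
  pos i := - c.pos (OrderDual.ofDual i)
  vel i := - c.vel (OrderDual.ofDual i)
  spin i := - c.spin (OrderDual.ofDual i)

theorem similar_mirror (c : Config ι) (S : Set ι) :
    c.Similar c.mirror S OrderDual.toDual 0 (-1) where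
  injective := OrderDual.toDual.injective
  pos i _ := by simp [mirror]
  vel i _ := by
    show ((- c.vel i : SignType) : ℤ) = _
    generalize c.vel i = v
    revert v; decide
  spin i _ := by simp [mirror]

end Similar

/-! ### Left-moving particles by reflection, and the order of velocities among survivors -/

section Order

variable {ι : Type*} [LinearOrder ι] {c : Config ι} {S T : Set ι} {i j k l : ι} {t u : ℝ}

theorem strictMono_mirror (hc : StrictMono c.pos) : StrictMono c.mirror.pos := by
  intro i j hij
  exact neg_lt_neg (hc (show OrderDual.ofDual j < OrderDual.ofDual i from hij))

/-- The fate of a left-moving particle only depends on the particles on its left. -/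
theorem match_Iic_iff (hc : StrictMono c.pos) (hS : c.LocallyFinite S) (hi : c.vel i = -1) :
    c.Match (S ∩ Set.Iic i) i j ↔ c.Match S i j := by
  have hc' := strictMono_mirror hc
  rw [← (c.similar_mirror S).match_iff hc.injective hc'.injective,
    ← (c.similar_mirror (S ∩ Set.Iic i)).match_iff hc.injective hc'.injective,
    Set.image_inter OrderDual.toDual.injective]
  have h1 : OrderDual.toDual '' Set.Iic i = Set.Ici (OrderDual.toDual i) := by
    ext x
    simp only [Set.mem_image, Set.mem_Iic, Set.mem_Ici]
    exact ⟨fun ⟨y, hy, hx⟩ => hx ▸ hy, fun h => ⟨OrderDual.ofDual x, h, rfl⟩⟩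
  rw [h1]
  refine match_Ici_iff hc' ?_ ?_
  · intro x r
    refine ((hS (-x) r).image OrderDual.toDual).subset ?_
    rintro _ ⟨⟨i, hi, rfl⟩, h⟩
    refine ⟨i, ⟨hi, ?_⟩, rfl⟩
    rw [← abs_neg]
    convert h using 2
    simp [mirror]
    ring
  · show - c.vel i = 1
    rw [hi]; rfl

theorem survives_Iic_iff (hc : StrictMono c.pos) (hS : c.LocallyFinite S) (hi : c.vel i = -1) :
    c.Survives (S ∩ Set.Iic i) i ↔ c.Survives S i := by
  simp [survives_iff, match_Iic_iff hc hS hi]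

theorem match_iff_of_vel_eq_one (hc : StrictMono c.pos) (hS : c.LocallyFinite S)
    (hT : c.LocallyFinite T) (hi : c.vel i = 1) (h : S ∩ Set.Ici i = T ∩ Set.Ici i) :
    c.Match S i j ↔ c.Match T i j := by
  rw [← match_Ici_iff hc hS hi, ← match_Ici_iff hc hT hi, h]

theorem match_iff_of_vel_eq_neg_one (hc : StrictMono c.pos) (hS : c.LocallyFinite S)
    (hT : c.LocallyFinite T) (hi : c.vel i = -1) (h : S ∩ Set.Iic i = T ∩ Set.Iic i) :
    c.Match S i j ↔ c.Match T i j := by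
  rw [← match_Iic_iff hc hS hi, ← match_Iic_iff hc hT hi, h]

theorem survives_iff_of_vel_eq_neg_one (hc : StrictMono c.pos) (hS : c.LocallyFinite S)
    (hT : c.LocallyFinite T) (hi : c.vel i = -1) (h : S ∩ Set.Iic i = T ∩ Set.Iic i) :
    c.Survives S i ↔ c.Survives T i := by
  rw [← survives_Iic_iff hc hS hi, ← survives_Iic_iff hc hT hi, h]

theorem exists_meet_of_vel_lt (hc : StrictMono c.pos) (hij : i < j)
    (hv : (c.vel j : ℝ) < c.vel i) : ∃ t, c.Meet i j t := by
  have hp := hc hij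
  refine ⟨(c.pos j - c.pos i) / (c.vel i - c.vel j), hij.ne, ?_, ?_⟩
  · exact div_nonneg (by linarith) (by linarith)
  · have : (c.vel i : ℝ) - c.vel j ≠ 0 := by linarith
    simp only [traj]
    field_simp
    ring

/-- The velocities of the surviving particles are nondecreasing. -/
theorem Survives.vel_le (hc : StrictMono c.pos) (hS : c.LocallyFinite S)
    (hi : c.Survives S i) (hj : c.Survives S j) (hij : i < j) : (c.vel i : ℝ) ≤ c.vel j := by
  by_contra! h
  obtain ⟨t, ht⟩ := exists_meet_of_vel_lt hc hij h
  exact hi.not_meet hc.injective hS hj ht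

theorem Survives.vel_eq_one (hc : StrictMono c.pos) (hS : c.LocallyFinite S)
    (hi : c.Survives S i) (hj : c.Survives S j) (hij : i < j) (h : c.vel i = 1) :
    c.vel j = 1 := by
  have := hi.vel_le hc hS hj hij
  rcases c.vel_cases j with h' | h' | h'
  · rw [h, h'] at this; norm_num at this
  · rw [h, h'] at this; norm_num at this
  · exact h'

theorem Survives.vel_eq_neg_one (hc : StrictMono c.pos) (hS : c.LocallyFinite S)
    (hi : c.Survives S i) (hj : c.Survives S j) (hij : i < j) (h : c.vel j = -1) :
    c.vel i = -1 := by
  have := hi.vel_le hc hS hj hij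
  rcases c.vel_cases i with h' | h' | h'
  · exact h'
  · rw [h, h'] at this; norm_num at this
  · rw [h, h'] at this; norm_num at this

end Order

end Config
end BallisticAnnihilation

namespace BallisticAnnihilation
namespace Config

section Count

variable {ι : Type*} {c : Config ι} {i : ι}

/-! ### Counting surviving particles -/

open Classical in
/-- The contribution of a particle to the count: `+1` if static, `-1` if left-moving. -/
noncomputable def charge (c : Config ι) (i : ι) : ℤ :=
  (if c.vel i = 0 then 1 else 0) - (if c.vel i = -1 then 1 else 0)

open Classical in
/-- In the process restricted to `F`, the number of surviving static particles minus the number of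
surviving left-moving particles. -/
noncomputable def netSum (c : Config ι) (F : Finset ι) : ℤ :=
  ∑ i ∈ F, c.charge i * (if c.Survives F i then 1 else 0)

theorem charge_of_vel_eq_one (h : c.vel i = 1) : c.charge i = 0 := by
  simp [charge, h]

theorem neg_one_le_charge (c : Config ι) (i : ι) : -1 ≤ c.charge i := by
  rcases c.vel_cases i with h | h | h <;> simp [charge, h]

theorem charge_le_one (c : Config ι) (i : ι) : c.charge i ≤ 1 := by
  rcases c.vel_cases i with h | h | h <;> simp [charge, h]

theorem abs_netSum_le (c : Config ι) (F : Finset ι) : |c.netSum F| ≤ F.card := by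
  refine (Finset.abs_sum_le_sum_abs _ _).trans ?_
  rw [Finset.card_eq_sum_ones]
  push_cast
  refine Finset.sum_le_sum fun i _ => ?_
  have := abs_le.2 ⟨c.neg_one_le_charge i, c.charge_le_one i⟩
  split_ifs <;> simp [this]

end Count

/-! ### Removal of the rightmost particle and superadditivity of the count -/

section Order

variable {ι : Type*} [LinearOrder ι] {c : Config ι} {S T : Set ι} {i j k l e : ι} {t u : ℝ}

/-- When the rightmost particle `e` is removed, the annihilations of right-moving particles by
another particle than `e` are unchanged. -/
theorem Match.inter_Iio (hc : StrictMono c.pos) (hS : S.Finite) (hj : c.vel i = 1)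
    (hm : c.Match S i j) (hje : j < e) : c.Match (S ∩ Set.Iio e) i j := by
  have hLF : c.LocallyFinite S := locallyFinite_of_finite hS
  have hLF' : c.LocallyFinite (S ∩ Set.Iio e) := hLF.mono Set.inter_subset_left
  have hL : ∀ b x, c.vel b = -1 → b < e → (c.Match (S ∩ Set.Iio e) b x ↔ c.Match S b x) := by
    intro b x hb hbe
    refine match_iff_of_vel_eq_neg_one hc hLF' hLF hb ?_
    ext y
    simp only [Set.mem_inter_iff, Set.mem_Iio, Set.mem_Iic]
    exact ⟨fun h => ⟨h.1.1, h.2⟩, fun h => ⟨⟨h.1, h.2.trans_lt hbe⟩, h.2⟩⟩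
  have hinj := hc.injective
  -- The induction is on the number of particles starting in `[i, j]`. Nested pairs with a
  -- right-moving member are covered by `IH`, and those with a left-moving member by `hL`, so
  -- everything strictly inside stays paired inside.
  induction hn : (S ∩ Set.Icc i j).ncard using Nat.strong_induction_on generalizing i j with
  | _ n ih =>
  subst hn
  have hij := hm.lt_of_vel_eq_one hc hj
  have IH : ∀ g f, i < g → f < j → c.vel g = 1 → c.Match S g f →
      c.Match (S ∩ Set.Iio e) g f := by
    intro g f hg hf hv hgf
    refine ih _ (Set.ncard_lt_ncard ?_ (hS.inter_of_left _)) hv hgf (hf.trans hje) rfl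
    refine ⟨fun x hx => ⟨hx.1, hg.le.trans hx.2.1, hx.2.2.trans hf.le⟩, fun hsub => ?_⟩
    exact (hsub ⟨hm.mem_left, le_rfl, hij.le⟩).2.1.not_gt hg
  have hin : ∀ x ∈ S, i < x → x < j → ∃ y, i < y ∧ y < j ∧ c.Match (S ∩ Set.Iio e) x y := by
    intro x hx hix hxj
    obtain ⟨y, hy1, hy2, hxy⟩ := hm.between hc hx hix hxj
    refine ⟨y, hy1, hy2, ?_⟩
    rcases c.vel_cases x with h | h | h
    · exact (hL x y h (hxj.trans hje)).2 hxy
    · rcases c.vel_cases y with h' | h' | h'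
      · exact ((hL y x h' (hy2.trans hje)).2 hxy.symm).symm
      · exact absurd (h.trans h'.symm) (hxy.vel_ne hc)
      · exact (IH y x hy1 hxj h' hxy.symm).symm
    · exact IH x y hix hy2 h hxy
  rcases c.vel_cases j with h | h | h
  · exact ((hL j i h hje).2 hm.symm).symm
  swap
  · exact absurd (hj.trans h.symm) (hm.vel_ne hc)
  by_contra hcon
  have hiS : i ∈ S ∩ Set.Iio e := ⟨hm.mem_left, hij.trans hje⟩
  have hjS : j ∈ S ∩ Set.Iio e := ⟨hm.mem_right, hje⟩
  have hi_out : ∀ y, y < j → ¬ c.Match (S ∩ Set.Iio e) i y := by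
    intro y hyj hy
    obtain ⟨z, hz1, -, hz⟩ := hin y hy.mem_right.1 (hy.lt_of_vel_eq_one hc hj) hyj
    rw [hy.symm.unique hinj hz] at hz1
    exact lt_irrefl _ hz1
  by_cases hsj : c.Survives (S ∩ Set.Iio e) j
  · by_cases hsi : c.Survives (S ∩ Set.Iio e) i
    · obtain ⟨t, ht⟩ := hm
      exact hsi.not_meet hinj hLF' hsj ht.meet
    · obtain ⟨y, hy⟩ := exists_match hiS hsi
      rcases lt_trichotomy y j with hyj | rfl | hyj
      · exact hi_out y hyj hy
      · exact hcon hy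
      · obtain ⟨z, -, -, hz⟩ := hy.between hc hjS hij hyj
        exact hsj.not_match hz
  · obtain ⟨b, hb⟩ := exists_match hjS hsj
    rcases lt_trichotomy b i with hbi | rfl | hbi
    · obtain ⟨z, -, hz2, hz⟩ := hb.symm.between hc hiS hbi hij
      exact hi_out z hz2 hz
    · exact hcon hb.symm
    rcases lt_trichotomy b j with hbj | rfl | hbj
    · obtain ⟨z, -, hz2, hz⟩ := hin b hb.mem_right.1 hbi hbj
      rw [hb.symm.unique hinj hz] at hz2
      exact lt_irrefl _ hz2
    · exact hb.ne rfl
    -- The remaining danger is that the static `j` is taken by a particle from its right. That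
    -- particle is left-moving, so its fate does not depend on `e`, and it would already be paired
    -- with `j` in `S`.
    · have hvb : c.vel b = -1 := by
        have := hb.vel_lt hc hbj
        rcases c.vel_cases b with h' | h' | h'
        · exact h'
        · rw [h, h'] at this; norm_num at this
        · rw [h, h'] at this; norm_num at this
      have h2 := (hL b j hvb hb.mem_right.2).1 hb.symm
      exact hbi.ne' (hm.symm.unique hinj h2.symm)

theorem netSum_eq_of_closed (hc : StrictMono c.pos) {F G : Finset ι}
    (h : c.Closed (F : Set ι) G)
    (hz : ∀ i ∈ F, i ∉ G → c.Survives F i → c.charge i = 0) : c.netSum F = c.netSum G := by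
  have hGF : G ⊆ F := Finset.coe_subset.1 h.1
  have hLF : c.LocallyFinite (F : Set ι) := locallyFinite_of_finite F.finite_toSet
  classical
  unfold netSum
  rw [← Finset.sum_subset hGF]
  · refine Finset.sum_congr rfl fun i hi => ?_
    simp only [h.survives_iff hc.injective hLF (Finset.mem_coe.2 hi)]
  · intro i hi hiG
    by_cases hs : c.Survives F i
    · rw [hz i hi hiG hs, zero_mul]
    · rw [if_neg hs, mul_zero]

/-- Survivors to the right of a right-moving survivor are right-moving too, hence not counted: while
`j` survives, the count is frozen. -/
theorem Survives.netSum_eq (hc : StrictMono c.pos) {F : Finset ι} (hv : c.vel j = 1)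
    (h : c.Survives F j) : c.netSum F = c.netSum (F.filter (· < j)) := by
  refine netSum_eq_of_closed hc ?_ ?_
  · convert h.closed_Iio hc using 1
    ext x; simp
  · intro i hi hij hs
    simp only [Finset.mem_filter, not_and, not_lt] at hij
    rcases eq_or_lt_of_le (hij hi) with rfl | hlt
    · exact charge_of_vel_eq_one hv
    · exact charge_of_vel_eq_one
        (h.vel_eq_one hc (locallyFinite_of_finite F.finite_toSet) hs hlt hv)

/-- The block from `j` to the last particle `e` annihilates entirely, by nestedness. -/
theorem Match.netSum_eq (hc : StrictMono c.pos) {F : Finset ι} (h : c.Match F j e) (hje : j < e)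
    (he : ∀ i ∈ F, i ≤ e) : c.netSum F = c.netSum (F.filter (· < j)) := by
  refine netSum_eq_of_closed hc ?_ ?_
  · convert (h.closed_Icc hc hje).diff using 1
    ext x
    simp only [Finset.coe_filter, Set.mem_ofPred_eq, Set.mem_sdiff, Set.mem_inter_iff,
      Set.mem_Icc, not_and, not_le, Finset.mem_coe]
    exact ⟨fun hx => ⟨hx.1, fun _ hjx => absurd hx.2 hjx.not_gt⟩, fun hx => ⟨hx.1, by
      by_contra! hjx
      exact (hx.2 hx.1 hjx).not_ge (he x hx.1)⟩⟩
  · intro i hi hij hs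
    simp only [Finset.mem_filter, not_and, not_lt] at hij
    rcases eq_or_lt_of_le (hij hi) with rfl | hlt
    · exact absurd h hs.not_match
    rcases eq_or_lt_of_le (he i hi) with rfl | hlt'
    · exact absurd h.symm hs.not_match
    · obtain ⟨z, -, -, hz⟩ := h.between hc hi hlt hlt'
      exact absurd hz hs.not_match

open Classical in
/-- The gain of a right-moving particle `i`: `+1` if it annihilates with a left-moving particle,
`-1` if with a static one. -/
noncomputable def gain (c : Config ι) (F : Finset ι) (i : ι) : ℤ :=
  ∑ j ∈ F, if c.Match F i j then - c.charge j else 0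

theorem gain_of_match (hc : StrictMono c.pos) {F : Finset ι} (h : c.Match F i j) :
    c.gain F i = - c.charge j := by
  unfold gain
  rw [Finset.sum_eq_single j, if_pos h]
  · intro b _ hb
    exact if_neg fun h' => hb (h.unique hc.injective h')
  · intro hj
    exact absurd h.mem_right hj

theorem neg_one_le_gain (hc : StrictMono c.pos) (F : Finset ι) (i : ι) : -1 ≤ c.gain F i := by
  by_cases h : ∃ j, c.Match F i j
  · obtain ⟨j, hj⟩ := h
    rw [gain_of_match hc hj]
    linarith [c.charge_le_one j]
  · push Not at h
    simp [gain, h]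

open Classical in
-- The count is the total charge minus the charge of the annihilated particles. A pair of a static
-- and a left-moving particle has total charge 0, so only the partners of right-moving particles
-- contribute. This turns comparisons of counts into comparisons of individual fates.
theorem netSum_eq_sum_gain (hc : StrictMono c.pos) (F : Finset ι) :
    c.netSum F = ∑ i ∈ F, c.charge i + ∑ i ∈ F, if c.vel i = 1 then c.gain F i else 0 := by
  have hs : ∀ i ∈ F, (if c.Survives F i then 1 else 0 : ℤ) =
      1 - ∑ j ∈ F, if c.Match F i j then 1 else 0 := by
    intro i hi
    by_cases h : c.Survives F i
    · simp [h, h.not_match]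
    · obtain ⟨j, hj⟩ := exists_match (Finset.mem_coe.2 hi) h
      rw [if_neg h, Finset.sum_eq_single j, if_pos hj, sub_self]
      · intro b _ hb
        exact if_neg fun h' => hb (hj.unique hc.injective h')
      · intro hj'
        exact absurd hj.mem_right hj'
  have h1 : c.netSum F = ∑ i ∈ F, c.charge i -
      ∑ i ∈ F, ∑ j ∈ F, if c.Match F i j then c.charge i else 0 := by
    unfold netSum
    rw [← Finset.sum_sub_distrib]
    refine Finset.sum_congr rfl fun i hi => ?_
    rw [hs i hi, mul_sub, mul_one, Finset.mul_sum]
    simp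
  have h2 : (∑ i ∈ F, if c.vel i = 1 then c.gain F i else 0) =
      ∑ i ∈ F, ∑ j ∈ F, if c.Match F i j ∧ c.vel i = 1 then - c.charge j else 0 := by
    refine Finset.sum_congr rfl fun i _ => ?_
    by_cases h : c.vel i = 1 <;> simp [h, gain]
  -- the pairs of a static and a left-moving particle cancel out
  have h3 : ∑ i ∈ F, ∑ j ∈ F, (if c.Match F i j then c.charge i else 0) +
      ∑ i ∈ F, ∑ j ∈ F, (if c.Match F i j ∧ c.vel j = 1 then - c.charge i else 0) = 0 := by
    set g : ι → ι → ℤ := fun i j => (if c.Match F i j then c.charge i else 0) +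
      (if c.Match F i j ∧ c.vel j = 1 then - c.charge i else 0) with hg
    have hanti : ∀ i j, g i j = - g j i := by
      intro i j
      have hsymm : c.Match F j i ↔ c.Match F i j := ⟨Match.symm, Match.symm⟩
      simp only [hg, hsymm]
      by_cases hm : c.Match F i j
      · have hne := hm.vel_ne hc
        rcases c.vel_cases i with h | h | h <;> rcases c.vel_cases j with h' | h' | h' <;>
          simp [hm, h, h', charge] at hne ⊢
      · simp [hm]
    have h4 : ∑ i ∈ F, ∑ j ∈ F, g i j = - ∑ i ∈ F, ∑ j ∈ F, g i j := by
      conv_lhs => rw [Finset.sum_comm]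
      simp only [← Finset.sum_neg_distrib]
      exact Finset.sum_congr rfl fun i _ => Finset.sum_congr rfl fun j _ => hanti j i
    rw [← Finset.sum_add_distrib]
    simp only [← Finset.sum_add_distrib]
    show ∑ i ∈ F, ∑ j ∈ F, g i j = 0
    linarith
  rw [h1, h2, Finset.sum_comm (f := fun i j => if c.Match F i j ∧ c.vel i = 1 then _ else _)]
  have h5 : (∑ j ∈ F, ∑ i ∈ F, if c.Match F i j ∧ c.vel i = 1 then - c.charge j else 0) =
      ∑ i ∈ F, ∑ j ∈ F, (if c.Match F i j ∧ c.vel j = 1 then - c.charge i else 0) := by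
    refine Finset.sum_congr rfl fun i _ => Finset.sum_congr rfl fun j _ => ?_
    rw [show c.Match F j i ↔ c.Match F i j from ⟨Match.symm, Match.symm⟩]
  rw [h5]
  linarith

/-- No gain decreases when `A` and `B` are joined. A right-moving particle of `B` only sees its
right, so its gain is unchanged. One of `A` has a partner in `A`: if this is left-moving, the pair
persists because a left-moving particle only sees its left; if it is static, the gain in `A` is -1,
the least possible. A right-moving survivor of `A`, with gain 0, could destroy a static particle of
`B`, whence `hA`. -/
theorem netSum_union_le (hc : StrictMono c.pos) {A B : Finset ι} (hAB : ∀ a ∈ A, ∀ b ∈ B, a < b)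
    (hA : ∀ i ∈ A, c.vel i = 1 → ¬ c.Survives A i) :
    c.netSum A + c.netSum B ≤ c.netSum (A ∪ B) := by
  classical
  have hdisj : Disjoint A B := Finset.disjoint_left.2 fun x ha hb => (hAB x ha x hb).false
  have hLF : ∀ F : Finset ι, c.LocallyFinite (F : Set ι) := fun F =>
    locallyFinite_of_finite F.finite_toSet
  rw [netSum_eq_sum_gain hc, netSum_eq_sum_gain hc, netSum_eq_sum_gain hc,
    Finset.sum_union hdisj, Finset.sum_union hdisj]
  have h1 : ∑ i ∈ B, (if c.vel i = 1 then c.gain B i else 0) ≤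
      ∑ i ∈ B, (if c.vel i = 1 then c.gain (A ∪ B) i else 0) := by
    refine Finset.sum_le_sum fun i hi => ?_
    by_cases hv : c.vel i = 1
    · rw [if_pos hv, if_pos hv]
      have hm : ∀ j, c.Match (A ∪ B : Finset ι) i j ↔ c.Match B i j := fun j => by
        refine match_iff_of_vel_eq_one hc (hLF _) (hLF _) hv ?_
        ext x
        simp only [Finset.coe_union, Set.mem_inter_iff, Set.mem_union, Finset.mem_coe, Set.mem_Ici]
        exact ⟨fun hx => ⟨hx.1.resolve_left fun ha => (hAB x ha i hi).not_ge hx.2, hx.2⟩,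
          fun hx => ⟨Or.inr hx.1, hx.2⟩⟩
      refine le_of_eq ?_
      unfold gain
      simp only [hm]
      refine Finset.sum_subset Finset.subset_union_right fun j _ hj => ?_
      exact if_neg fun h => hj h.mem_right
    · simp [hv]
  have h2 : ∑ i ∈ A, (if c.vel i = 1 then c.gain A i else 0) ≤
      ∑ i ∈ A, (if c.vel i = 1 then c.gain (A ∪ B) i else 0) := by
    refine Finset.sum_le_sum fun i hi => ?_
    by_cases hv : c.vel i = 1
    · rw [if_pos hv, if_pos hv]
      obtain ⟨j, hj⟩ := exists_match (Finset.mem_coe.2 hi) (hA i hi hv)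
      rw [gain_of_match hc hj]
      rcases c.vel_cases j with h | h | h
      · have hm : c.Match (A ∪ B : Finset ι) j i := by
          refine (match_iff_of_vel_eq_neg_one hc (hLF _) (hLF _) h ?_).2 hj.symm
          ext x
          simp only [Finset.coe_union, Set.mem_inter_iff, Set.mem_union, Finset.mem_coe,
            Set.mem_Iic]
          exact ⟨fun hx => ⟨hx.1.resolve_right fun hb => (hAB j hj.mem_right x hb).not_ge hx.2,
            hx.2⟩, fun hx => ⟨Or.inl hx.1, hx.2⟩⟩
        rw [gain_of_match hc hm.symm]
      · refine le_trans ?_ (neg_one_le_gain hc _ _)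
        simp [charge, h]
      · exact absurd (hv.trans h.symm) (hj.vel_ne hc)
    · simp [hv]
  linarith

/-- If a left-moving rightmost particle survives, then no static particle does. -/
theorem Survives.netSum_lt_zero (hc : StrictMono c.pos) {F : Finset ι} (h : c.Survives F i)
    (hv : c.vel i = -1) (hi : ∀ j ∈ F, j ≤ i) : c.netSum F < 0 := by
  classical
  have hLF : c.LocallyFinite (F : Set ι) := locallyFinite_of_finite F.finite_toSet
  unfold netSum
  refine Finset.sum_neg' (fun j hj => ?_) ⟨i, h.1, ?_⟩
  · by_cases hs : c.Survives F j
    · have hvj : c.vel j = -1 := by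
        rcases eq_or_lt_of_le (hi j hj) with rfl | hlt
        · exact hv
        · exact hs.vel_eq_neg_one hc hLF h hlt hv
      simp [charge, hvj, hs]
    · simp [hs]
  · simp [charge, hv, h]

end Order

end Config
end BallisticAnnihilation

namespace BallisticAnnihilation
namespace Config

/-! ### One-sided descriptions of annihilation and survival -/

section Order

variable {ι : Type*} [LinearOrder ι] {c : Config ι} {S T : Set ι} {i j k l e z a b : ι} {t u : ℝ}

/-- Removing the target `z` leaves `j` without a partner: a substitute partner `f` would start
strictly between `j` and `z`, where `f` already has a partner, and that pair persists without `z`.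
Thus the destruction of `z` is read off the particles on one side of it. -/
theorem Match.survives_Ico (hc : StrictMono c.pos) (hS : (S ∩ Set.Icc j z).Finite)
    (h : c.Match S j z) (hjz : j < z) (hv : c.vel j = 1) : c.Survives (S ∩ Set.Ico j z) j := by
  have h0 := (h.closed_Icc hc hjz).match_of_match hc.injective ⟨h.mem_left, le_rfl, hjz.le⟩ h
  have hset : S ∩ Set.Ico j z = (S ∩ Set.Icc j z) ∩ Set.Iio z := by
    ext x
    simp only [Set.mem_inter_iff, Set.mem_Ico, Set.mem_Icc, Set.mem_Iio]
    exact ⟨fun hx => ⟨⟨hx.1, hx.2.1, hx.2.2.le⟩, hx.2.2⟩, fun hx => ⟨hx.1.1, hx.1.2.1, hx.2⟩⟩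
  rw [hset]
  generalize S ∩ Set.Icc j z = S₀ at *
  have hLF : c.LocallyFinite S₀ := locallyFinite_of_finite hS
  have hLF' : c.LocallyFinite (S₀ ∩ Set.Iio z) := hLF.mono Set.inter_subset_left
  have hL : ∀ b x, c.vel b = -1 → b < z → (c.Match (S₀ ∩ Set.Iio z) b x ↔ c.Match S₀ b x) := by
    intro b x hb hbe
    refine match_iff_of_vel_eq_neg_one hc hLF' hLF hb ?_
    ext y
    simp only [Set.mem_inter_iff, Set.mem_Iio, Set.mem_Iic]
    exact ⟨fun h => ⟨h.1.1, h.2⟩, fun h => ⟨⟨h.1, h.2.trans_lt hbe⟩, h.2⟩⟩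
  rw [survives_iff]
  refine ⟨⟨h0.mem_left, hjz⟩, fun f hf => ?_⟩
  have hfz : f < z := hf.mem_right.2
  have hjf := hf.lt_of_vel_eq_one hc hv
  obtain ⟨g, hg1, hg2, hfg⟩ := h0.between hc hf.mem_right.1 hjf hfz
  have hcon : ¬ c.Match (S₀ ∩ Set.Iio z) f g := fun h' =>
    hg1.ne' (hf.symm.unique hc.injective h')
  rcases c.vel_cases f with hvf | hvf | hvf
  · exact hcon ((hL f g hvf hfz).2 hfg)
  · rcases c.vel_cases g with hvg | hvg | hvg
    · exact hcon ((hL g f hvg hg2).2 hfg.symm).symm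
    · exact hfg.vel_ne hc (hvf.trans hvg.symm)
    · exact hcon (hfg.symm.inter_Iio hc hS hvg hfz).symm
  · exact hf.vel_ne hc (hv.trans hvf.symm)

theorem Match.survives_Ioc (hc : StrictMono c.pos) (hS : (S ∩ Set.Icc z j).Finite)
    (h : c.Match S j z) (hzj : z < j) (hv : c.vel j = -1) : c.Survives (S ∩ Set.Ioc z j) j := by
  have hc' := strictMono_mirror hc
  have h' := ((c.similar_mirror S).match_iff hc.injective hc'.injective).2 h
  rw [← (c.similar_mirror _).survives_iff hc.injective hc'.injective,
    Set.image_inter OrderDual.toDual.injective]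
  have h1 : OrderDual.toDual '' Set.Ioc z j
      = Set.Ico (OrderDual.toDual j) (OrderDual.toDual z) := by
    ext x
    simp only [Set.mem_image, Set.mem_Ioc, Set.mem_Ico]
    exact ⟨fun ⟨y, hy, hx⟩ => hx ▸ ⟨hy.2, hy.1⟩, fun h => ⟨OrderDual.ofDual x, ⟨h.2, h.1⟩, rfl⟩⟩
  rw [h1]
  refine h'.survives_Ico hc' ?_ hzj ?_
  · refine (hS.image OrderDual.toDual).subset ?_
    rintro _ ⟨⟨x, hx, rfl⟩, hx'⟩
    exact ⟨x, ⟨hx, hx'.2, hx'.1⟩, rfl⟩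
  · show - c.vel j = 1
    rw [hv]; rfl

/-- A static particle which survives does so in any window around it. -/
theorem Survives.inter_Icc (hc : StrictMono c.pos) (hS : c.LocallyFinite S)
    (h : c.Survives S z) (hv : c.vel z = 0) (ha : a ≤ z) (hb : z ≤ b) :
    c.Survives (S ∩ Set.Icc a b) z := by
  rw [survives_iff]
  refine ⟨⟨h.1, ha, hb⟩, fun y hy => ?_⟩
  rcases lt_or_gt_of_ne hy.ne with hlt | hlt
  · have hvy : c.vel y = -1 := by
      have := hy.vel_lt hc hlt
      rcases c.vel_cases y with h' | h' | h'
      · exact h'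
      · rw [hv, h'] at this; norm_num at this
      · rw [hv, h'] at this; norm_num at this
    have h1 := (hy.closed_Icc hc hlt).match_of_match hc.injective ⟨hy.mem_left, le_rfl, hlt.le⟩ hy
    have h2 : S ∩ Set.Icc a b ∩ Set.Icc z y = S ∩ Set.Ici z ∩ Set.Iic y := by
      ext x
      simp only [Set.mem_inter_iff, Set.mem_Icc, Set.mem_Ici, Set.mem_Iic]
      exact ⟨fun hx => ⟨⟨hx.1.1, hx.2.1⟩, hx.2.2⟩, fun hx => ⟨⟨hx.1.1, ha.trans hx.1.2,
        hx.2.trans hy.mem_right.2.2⟩, hx.1.2, hx.2⟩⟩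
    -- The pair `z`, `y` forms in `[z, y]`; as the left-moving `y` only sees its left, it also forms
    -- in the process on `[z, ∞)`, where `z` survives.
    rw [h2] at h1
    have h3 := (match_Iic_iff hc (hS.mono Set.inter_subset_left) hvy).1 h1.symm
    exact (((h.closed_Ici hc).survives_iff hc.injective hS ⟨h.1, le_rfl⟩).2 h).not_match h3.symm
  · have hvy : c.vel y = 1 := by
      have := hy.symm.vel_lt hc hlt
      rcases c.vel_cases y with h' | h' | h'
      · rw [hv, h'] at this; norm_num at this
      · rw [hv, h'] at this; norm_num at this
      · exact h'
    have h1 := (hy.symm.closed_Icc hc hlt).match_of_match hc.injective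
      ⟨hy.mem_right, le_rfl, hlt.le⟩ hy.symm
    have h2 : S ∩ Set.Icc a b ∩ Set.Icc y z = S ∩ Set.Iic z ∩ Set.Ici y := by
      ext x
      simp only [Set.mem_inter_iff, Set.mem_Icc, Set.mem_Ici, Set.mem_Iic]
      exact ⟨fun hx => ⟨⟨hx.1.1, hx.2.2⟩, hx.2.1⟩, fun hx => ⟨⟨hx.1.1,
        hy.mem_right.2.1.trans hx.2, hx.1.2.trans hb⟩, hx.2, hx.1.2⟩⟩
    rw [h2] at h1
    have h3 := (match_Ici_iff hc (hS.mono Set.inter_subset_left) hvy).1 h1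
    exact (((h.closed_Iic hc).survives_iff hc.injective hS ⟨h.1, le_rfl⟩).2 h).not_match h3.symm

/-- If two left-moving particles exit on the left, the second one also exits from the process
started on the right of the first one. -/
theorem Survives.inter_Ioi (hc : StrictMono c.pos) (hS : c.LocallyFinite S)
    (hi : c.Survives (S ∩ Set.Iic i) i) (hvi : c.vel i = -1) (hj : c.Survives S j) (hij : i < j) :
    c.Survives (S ∩ Set.Ioi i) j := by
  have h1 := (survives_Iic_iff hc hS hvi).1 hi
  exact ((h1.closed_Ioi hc).survives_iff hc.injective hS ⟨hj.1, hij⟩).2 hj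

end Order

/-! ### Splitting off a block without right-moving survivors -/

section Nat

variable {c : Config ℕ}

/-- If the count ever goes below `-k`, then the particles before that may be split so that the
first part has no surviving right-moving particle and a count at least that of the first `k`
particles. -/
theorem exists_split (hc : StrictMono c.pos) {k i : ℕ} (h : c.netSum (Finset.range i) < -k) :
    ∃ s, k ≤ s ∧ s ≤ i ∧ (∀ j < s, c.vel j = 1 → ¬ c.Survives (Finset.range s) j) ∧
      c.netSum (Finset.range k) ≤ c.netSum (Finset.range s) := by
  have hki : k < i := by
    have := neg_le_of_abs_le (c.abs_netSum_le (Finset.range i))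
    rw [Finset.card_range] at this
    omega
  -- If no right-moving particle survives among the first `k`, split at `k`; otherwise follow the
  -- leftmost such survivor `j` until its annihilation.
  by_cases hR : ∃ j, j < k ∧ c.vel j = 1 ∧ c.Survives (Finset.range k) j
  swap
  · push Not at hR
    exact ⟨k, le_rfl, hki.le, hR, le_rfl⟩
  classical
  obtain ⟨hjk, hvj, hsj⟩ := Nat.find_spec hR
  have hmin := fun x (hx : x < Nat.find hR) => Nat.find_min hR hx
  generalize Nat.find hR = j at hjk hvj hsj hmin
  have hfil : ∀ n, j ≤ n → (Finset.range n).filter (· < j) = Finset.range j := by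
    intro n hn
    ext x
    simp only [Finset.mem_filter, Finset.mem_range]
    omega
  have hNk : c.netSum (Finset.range k) = c.netSum (Finset.range j) := by
    rw [hsj.netSum_eq hc hvj, hfil k hjk.le]
  have hNj := neg_le_of_abs_le (c.abs_netSum_le (Finset.range j))
  rw [Finset.card_range] at hNj
  -- As long as `j` survives, the count is that of the first `j` particles, at least `-j > -k`; the
  -- level reached at `i` requires the annihilation of `j`.
  have hdie : ∃ n, k ≤ n ∧ ¬ c.Survives (Finset.range n) j := by
    refine ⟨i, hki.le, fun hs => ?_⟩
    rw [hs.netSum_eq hc hvj, hfil i (by omega)] at h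
    omega
  obtain ⟨hkn, hnj⟩ := Nat.find_spec hdie
  have hmin' := fun x (hx : x < Nat.find hdie) => Nat.find_min hdie hx
  have hni : Nat.find hdie ≤ i := by
    by_contra! hlt
    have := hmin' i hlt
    simp only [not_and, not_not] at this
    have hs := this hki.le
    rw [hs.netSum_eq hc hvj, hfil i (by omega)] at h
    omega
  generalize Nat.find hdie = n at hkn hnj hmin' hni
  have hkn' : k < n := lt_of_le_of_ne hkn (by rintro rfl; exact hnj hsj)
  obtain ⟨s, rfl⟩ : ∃ s, n = s + 1 := ⟨n - 1, by omega⟩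
  have hss : c.Survives (Finset.range s) j := by
    have := hmin' s (by omega)
    simp only [not_and, not_not] at this
    exact this (by omega)
  obtain ⟨e, he⟩ := exists_match (Finset.mem_coe.2 (Finset.mem_range.2 (by omega))) hnj
  have hje := he.lt_of_vel_eq_one hc hvj
  have hes : e ≤ s := by
    have := Finset.mem_range.1 (Finset.mem_coe.1 he.mem_right)
    omega
  -- The partner of `j` is the newest particle, otherwise the pair would already exist without it.
  obtain rfl : e = s := by
    by_contra hne
    have h1 := he.inter_Iio hc (Finset.finite_toSet _) hvj (e := s) (by omega)
    have h2 : (Finset.range (s + 1) : Set ℕ) ∩ Set.Iio s = Finset.range s := by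
      ext x
      simp only [Finset.coe_range, Set.mem_inter_iff, Set.mem_Iio]
      omega
    rw [h2] at h1
    exact hss.not_match h1
  have hmax : ∀ x ∈ Finset.range (e + 1), x ≤ e := fun x hx => by
    have := Finset.mem_range.1 hx; omega
  have hLF : ∀ F : Finset ℕ, c.LocallyFinite (F : Set ℕ) := fun F =>
    locallyFinite_of_finite F.finite_toSet
  -- The block `[j, e]` disappears entirely. Among the particles before `j`, no right-moving one
  -- survives by minimality of `j`, and their count is that of the first `k` particles.
  refine ⟨e + 1, by omega, hni, ?_, ?_⟩
  · intro x hx hvx hsx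
    rcases lt_trichotomy x j with hxj | rfl | hxj
    · have hcl : c.Closed (Finset.range (e + 1) : Set ℕ) (Finset.range j) := by
        convert (he.closed_Icc hc hje).diff using 1
        ext y
        simp only [Finset.coe_range, Set.mem_Iio, Set.mem_sdiff, Set.mem_inter_iff, Set.mem_Icc]
        omega
      have hcl' : c.Closed (Finset.range k : Set ℕ) (Finset.range j) := by
        convert hsj.closed_Iio hc using 1
        ext y
        simp only [Finset.coe_range, Set.mem_Iio, Set.mem_inter_iff]
        omega
      have hxm : x ∈ (Finset.range j : Set ℕ) := by simpa using hxj
      have h1 := (hcl.survives_iff hc.injective (hLF _) hxm).2 hsx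
      have h2 := (hcl'.survives_iff hc.injective (hLF _) hxm).1 h1
      exact hmin x hxj ⟨by omega, hvx, h2⟩
    · exact hsx.not_match he
    · rcases eq_or_lt_of_le (hmax x (Finset.mem_range.2 hx)) with rfl | hxe
      · exact hsx.not_match he.symm
      · obtain ⟨y, -, -, hy⟩ := he.between hc hsx.1 hxj hxe
        exact hsx.not_match hy
  · rw [he.netSum_eq hc hje hmax, hfil _ (by omega), hNk]

end Nat

end Config
end BallisticAnnihilation

namespace BallisticAnnihilation
namespace Config

/-! ### Measurability -/

section Level

variable {ι : Type*} {c : Config ι} {S : Set ι} {i j k : ι} {t u : ℝ}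

/-- The only possible collision time of two particles. -/
noncomputable def meetTime (c : Config ι) (i j : ι) : ℝ :=
  (c.pos j - c.pos i) / ((c.vel i : ℝ) - c.vel j)

/-- Two particles virtually collide. -/
def WillMeet (c : Config ι) (i j : ι) : Prop :=
  i ≠ j ∧ c.vel i ≠ c.vel j ∧ 0 ≤ c.meetTime i j

theorem cast_vel_injective : Function.Injective (fun v : SignType => (v : ℝ)) := by
  intro x y h
  rcases SignType.trichotomy x with hx | hx | hx <;> rcases SignType.trichotomy y with hy | hy | hy <;>
    simp [hx, hy] at h ⊢ <;> norm_num at h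

theorem meet_iff (hc : Function.Injective c.pos) :
    c.Meet i j t ↔ c.WillMeet i j ∧ t = c.meetTime i j := by
  constructor
  · intro h
    have hv := vel_ne_of_traj_eq (hc.ne h.1) h.2.2
    have hv' : (c.vel i : ℝ) - c.vel j ≠ 0 := sub_ne_zero.2 (cast_vel_injective.ne hv)
    have ht : t = c.meetTime i j := by
      have h3 := h.2.2
      simp only [traj] at h3
      rw [meetTime, eq_div_iff hv']
      linarith
    exact ⟨⟨h.1, hv, ht ▸ h.2.1⟩, ht⟩
  · rintro ⟨⟨h1, h2, h3⟩, rfl⟩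
    have hv' : (c.vel i : ℝ) - c.vel j ≠ 0 := sub_ne_zero.2 (cast_vel_injective.ne h2)
    refine ⟨h1, h3, ?_⟩
    simp only [traj, meetTime]
    field_simp
    ring

/-- The pairs of particles whose annihilation is decided after `n` applications of the recursive
rule. -/
def Level (c : Config ι) (S : Set ι) : ℕ → ι → ι → Prop
  | 0, _, _ => False
  | n + 1, i, j => i ∈ S ∧ j ∈ S ∧ c.WillMeet i j ∧ ∀ k ∈ S, k ≠ i → k ≠ j →
      ∀ x, x = i ∨ x = j → c.WillMeet k x → c.meetTime k x ≤ c.meetTime i j →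
        (c.meetTime k x = c.meetTime i j ∧ c.Spares i j k) ∨
        ∃ k', k' ≠ i ∧ k' ≠ j ∧ c.meetTime k k' ≤ c.meetTime k x ∧ Level c S n k k'

theorem Level.mono {m n : ℕ} (hmn : m ≤ n) (h : c.Level S m i j) : c.Level S n i j := by
  induction m generalizing n i j with
  | zero => exact h.elim
  | succ m ih =>
    obtain ⟨n, rfl⟩ : ∃ n', n = n' + 1 := ⟨n - 1, by omega⟩
    obtain ⟨hi, hj, hm, h⟩ := h
    refine ⟨hi, hj, hm, fun k hk hki hkj x hx hkx hle => (h k hk hki hkj x hx hkx hle).imp_right ?_⟩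
    rintro ⟨k', h1, h2, h3, h4⟩
    exact ⟨k', h1, h2, h3, ih (by omega) h4⟩

/-- A derivation may branch over all of `S`; finiteness of `S` bounds the depths of the branches, so
annihilation becomes a countable union of measurable conditions. -/
theorem match_iff_level (hc : Function.Injective c.pos) (hS : S.Finite) :
    c.Match S i j ↔ ∃ n, c.Level S n i j := by
  constructor
  · rintro ⟨t, h⟩
    induction h with
    | @intro i j t hi hj hm p τ hne hann ih =>
      obtain ⟨hwm, rfl⟩ := (meet_iff hc).1 hm
      have key : ∀ k, ∃ n, k ∈ S → k ≠ i → k ≠ j → ∀ u ≤ c.meetTime i j,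
          (c.Meet k i u ∨ c.Meet k j u) → ¬ (u = c.meetTime i j ∧ c.Spares i j k) →
          c.Level S n k (p k) := by
        intro k
        by_cases H : k ∈ S ∧ k ≠ i ∧ k ≠ j ∧ ∃ u ≤ c.meetTime i j,
          (c.Meet k i u ∨ c.Meet k j u) ∧ ¬ (u = c.meetTime i j ∧ c.Spares i j k)
        · obtain ⟨h1, h2, h3, u, h4, h5, h6⟩ := H
          obtain ⟨n, hn⟩ := ih k h1 h2 h3 u h4 h5 h6
          exact ⟨n, fun _ _ _ _ _ _ _ => hn⟩
        · exact ⟨0, fun h1 h2 h3 u h4 h5 h6 => (H ⟨h1, h2, h3, u, h4, h5, h6⟩).elim⟩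
      choose N hN using key
      obtain ⟨n, hn⟩ := (hS.image N).bddAbove
      refine ⟨n + 1, hi, hj, hwm, fun k hk hki hkj x hx hkx hle => ?_⟩
      have hmeet : c.Meet k i (c.meetTime k x) ∨ c.Meet k j (c.meetTime k x) := by
        rcases hx with rfl | rfl
        · exact Or.inl ((meet_iff hc).2 ⟨hkx, rfl⟩)
        · exact Or.inr ((meet_iff hc).2 ⟨hkx, rfl⟩)
      by_cases hs : c.meetTime k x = c.meetTime i j ∧ c.Spares i j k
      · exact Or.inl hs
      · obtain ⟨a, b, d⟩ := hne k hk hki hkj _ hle hmeet hs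
        have h1 := hann k hk hki hkj _ hle hmeet hs
        have h2 := ((meet_iff hc).1 h1.meet).2
        exact Or.inr ⟨p k, a, b, h2 ▸ d,
          (hN k hk hki hkj _ hle hmeet hs).mono (hn ⟨k, hk, rfl⟩)⟩
  · rintro ⟨n, h⟩
    refine ⟨c.meetTime i j, ?_⟩
    induction n generalizing i j with
    | zero => exact h.elim
    | succ n ih =>
      obtain ⟨hi, hj, hm, h⟩ := h
      refine (annihilate_iff hc).2 ⟨hi, hj, (meet_iff hc).2 ⟨hm, rfl⟩, ?_⟩
      intro k hk hki hkj u hu hmu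
      obtain ⟨x, hx, hkx, rfl⟩ : ∃ x, (x = i ∨ x = j) ∧ c.WillMeet k x ∧ u = c.meetTime k x := by
        rcases hmu with hmu | hmu
        · exact ⟨i, Or.inl rfl, (meet_iff hc).1 hmu⟩
        · exact ⟨j, Or.inr rfl, (meet_iff hc).1 hmu⟩
      refine (h k hk hki hkj x hx hkx hu).imp_right ?_
      rintro ⟨k', h1, h2, h3, h4⟩
      exact ⟨k', _, h1, h2, h3, ih h4⟩

end Level

instance : DiscreteMeasurableSpace SignType := ⟨fun _ => trivial⟩

theorem measurable_units_val : Measurable (fun s : ℤˣ => (s : ℤ)) :=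
  comap_measurable _

instance : DiscreteMeasurableSpace ℤˣ := by
  refine ⟨fun s => ?_⟩
  rw [← Set.preimage_image_eq s Units.val_injective]
  exact measurable_units_val (MeasurableSet.of_discrete (s := Units.val '' s))

section Measurable

variable {Ω ι : Type*} [MeasurableSpace Ω] {C : Ω → Config ι} {S : Set ι}

/-- A random configuration. -/
structure IsMeasurable (C : Ω → Config ι) : Prop where
  injective : ∀ ω, Function.Injective (C ω).pos
  pos : ∀ i, Measurable fun ω => (C ω).pos i
  vel : ∀ i, Measurable fun ω => (C ω).vel i
  spin : ∀ i, Measurable fun ω => (C ω).spin i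

namespace IsMeasurable

variable (h : IsMeasurable C)
include h

theorem measurable_meetTime (i j : ι) : Measurable fun ω => (C ω).meetTime i j := by
  have hv : ∀ i, Measurable fun ω => ((C ω).vel i : ℝ) := fun i =>
    (measurable_of_countable (fun v : SignType => (v : ℝ))).comp (h.vel i)
  unfold meetTime
  exact ((h.pos j).sub (h.pos i)).div ((hv i).sub (hv j))

theorem measurable_willMeet (i j : ι) : Measurable fun ω => (C ω).WillMeet i j := by
  refine measurable_const.and (Measurable.and ?_ ?_)
  · have h2 : Measurable fun x : SignType × SignType => x.1 ≠ x.2 := measurable_of_countable _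
    exact h2.comp ((h.vel i).prodMk (h.vel j))
  · exact measurableSet_setOfPred.1 (measurableSet_le measurable_const (h.measurable_meetTime i j))

theorem measurable_spares (i j k : ι) : Measurable fun ω => (C ω).Spares i j k := by
  have key : ∀ x y : ι, Measurable fun ω => (C ω).vel x = 0 ∧ ((C ω).vel y : ℤ) = (C ω).spin x := by
    intro x y
    have h2 : Measurable fun q : (SignType × SignType) × ℤˣ => q.1.1 = 0 ∧ (q.1.2 : ℤ) = q.2 :=
      measurable_of_countable _
    exact h2.comp (((h.vel x).prodMk (h.vel y)).prodMk (h.spin x))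
  exact (key i k).or (key j k)

theorem measurable_level [Countable ι] (n : ℕ) (i j : ι) :
    Measurable fun ω => (C ω).Level S n i j := by
  induction n generalizing i j with
  | zero => exact measurable_const
  | succ n ih =>
    have hle : ∀ a b x y : ι, Measurable fun ω => (C ω).meetTime a b ≤ (C ω).meetTime x y :=
      fun a b x y => measurableSet_setOfPred.1
        (measurableSet_le (h.measurable_meetTime a b) (h.measurable_meetTime x y))
    have heq : ∀ a b x y : ι, Measurable fun ω => (C ω).meetTime a b = (C ω).meetTime x y :=
      fun a b x y => measurableSet_setOfPred.1
        (measurableSet_eq_fun (h.measurable_meetTime a b) (h.measurable_meetTime x y))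
    refine measurable_const.and (measurable_const.and ((h.measurable_willMeet i j).and ?_))
    refine Measurable.forall fun k => measurable_const.imp (measurable_const.imp
      (measurable_const.imp (Measurable.forall fun x => measurable_const.imp
        ((h.measurable_willMeet k x).imp ((hle _ _ _ _).imp (Measurable.or ?_ ?_))))))
    · exact (heq _ _ _ _).and (h.measurable_spares i j k)
    · exact Measurable.exists fun k' => measurable_const.and (measurable_const.and
        ((hle _ _ _ _).and (ih k k')))

theorem measurable_survives [Countable ι] (hS : S.Finite) (i : ι) :
    Measurable fun ω => (C ω).Survives S i := by
  have h1 : (fun ω => (C ω).Survives S i) =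
      fun ω => i ∈ S ∧ ∀ j, ¬ ∃ n, (C ω).Level S n i j := by
    funext ω
    rw [survives_iff]
    simp only [match_iff_level (h.injective ω) hS]
  rw [h1]
  exact measurable_const.and (Measurable.forall fun j =>
    (Measurable.exists fun n => h.measurable_level n i j).not)

theorem measurable_netSum [Countable ι] (F : Finset ι) : Measurable fun ω => (C ω).netSum F := by
  unfold netSum
  refine Finset.measurable_sum _ fun i _ => Measurable.mul ?_ ?_
  · classical
    have h2 : Measurable fun v : SignType => ((if v = 0 then 1 else 0) -
      (if v = -1 then 1 else 0) : ℤ) := measurable_of_countable _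
    exact h2.comp (h.vel i)
  · exact Measurable.ite (measurableSet_setOfPred.2 (h.measurable_survives F.finite_toSet i))
      measurable_const measurable_const

end IsMeasurable
end Measurable

end Config
end BallisticAnnihilation

namespace BallisticAnnihilation

/-! ### Product measures -/

section InfinitePi

variable {ι κ E : Type*} [MeasurableSpace E] {ρ : Measure E} [IsProbabilityMeasure ρ]

theorem measurePreserving_comp_injective {f : κ → ι} (hf : Function.Injective f) :
    MeasurePreserving (fun (ω : ι → E) i => ω (f i)) (Measure.infinitePi fun _ => ρ)
      (Measure.infinitePi fun _ => ρ) :=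
  ⟨by fun_prop, Measure.map_infinitePi_infinitePi_of_inj (P := fun _ => ρ) hf⟩

/-- Events which depend on disjoint finite sets of coordinates are independent. -/
theorem infinitePi_inter_of_disjoint {A B : Set (ι → E)} {s t : Finset ι} (hst : Disjoint s t)
    (hA : MeasurableSet A) (hB : MeasurableSet B)
    (hAs : ∀ x y : ι → E, (∀ i ∈ s, x i = y i) → (x ∈ A ↔ y ∈ A))
    (hBt : ∀ x y : ι → E, (∀ i ∈ t, x i = y i) → (x ∈ B ↔ y ∈ B)) :
    Measure.infinitePi (fun _ : ι => ρ) (A ∩ B) =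
      Measure.infinitePi (fun _ : ι => ρ) A * Measure.infinitePi (fun _ : ι => ρ) B := by
  classical
  obtain ⟨x₀⟩ : Nonempty E := nonempty_of_isProbabilityMeasure ρ
  have hind : iIndepFun (fun (i : ι) (ω : ι → E) => ω i) (Measure.infinitePi fun _ : ι => ρ) :=
    iIndepFun_infinitePi (P := fun _ : ι => ρ) (X := fun _ x => x) fun _ => measurable_id
  have h1 := hind.indepFun_finset s t hst fun i => measurable_pi_apply i
  -- Completing by an arbitrary value `x₀` exhibits an event that depends on the coordinates in `s`
  -- as the preimage of an event on those coordinates.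
  let ext (s : Finset ι) (x : s → E) : ι → E := fun i => if h : i ∈ s then x ⟨i, h⟩ else x₀
  have hext : ∀ s : Finset ι, Measurable (ext s) := fun s => by
    refine measurable_pi_lambda _ fun i => ?_
    by_cases h : i ∈ s
    · simpa only [ext, h, dite_true] using measurable_pi_apply _
    · simp only [ext, h, dite_false]; exact measurable_const
  have hA' : (fun (ω : ι → E) (i : s) => ω i) ⁻¹' (ext s ⁻¹' A) = A := by
    ext x
    exact hAs _ _ fun i hi => by simp [ext, hi]
  have hB' : (fun (ω : ι → E) (i : t) => ω i) ⁻¹' (ext t ⁻¹' B) = B := by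
    ext x
    exact hBt _ _ fun i hi => by simp [ext, hi]
  have h2 := h1.measure_inter_preimage_eq_mul (ext s ⁻¹' A) (ext t ⁻¹' B) (hext s hA) (hext t hB)
  rwa [hA', hB'] at h2

variable {F : Type*} [MeasurableSpace F] {μ : Measure E} [IsProbabilityMeasure μ] {ν : Measure F}
  [IsProbabilityMeasure ν]

/-- An i.i.d. sequence of law `μ ⊗ ν`, obtained from independent sequences for both components. -/
theorem map_infinitePi_bool : (Measure.infinitePi fun _ : ι × Bool => μ.prod ν).map
      (fun ω i => ((ω (i, true)).1, (ω (i, false)).2)) =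
    Measure.infinitePi fun _ : ι => μ.prod ν := by
  have h1 := Measure.infinitePi_map_curry (fun (_ : ι) (_ : Bool) => μ.prod ν)
  have h2 := Measure.infinitePi_map_pi (fun _ : ι => Measure.infinitePi fun _ : Bool => μ.prod ν)
    (f := fun _ x => ((x true).1, (x false).2)) fun _ => by fun_prop
  have h3 : (Measure.infinitePi fun _ : Bool => μ.prod ν).map
      (fun x => ((x true).1, (x false).2)) = μ.prod ν := by
    have h4 := Measure.infinitePi_map_eval_prod (P := fun _ : Bool => μ.prod ν)
      (i := true) (j := false) (by decide)
    have h5 : (fun x : Bool → E × F => ((x true).1, (x false).2)) =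
        (Prod.map Prod.fst Prod.snd) ∘ fun x : Bool → E × F => (x true, x false) := rfl
    rw [h5, ← Measure.map_map (by fun_prop) (by fun_prop), h4,
      ← Measure.map_prod_map _ _ measurable_fst measurable_snd]
    simp
  rw [h3] at h2
  rw [← h2, ← h1, Measure.map_map (by fun_prop) (by fun_prop)]
  rfl

/-- Meant for the reflection of the line: a gap is attached to its right endpoint, so after
reflection the gap and the velocity of a particle come from different indices. -/
theorem measurePreserving_shuffle {a b : κ → ι} (ha : Function.Injective a)
    (hb : Function.Injective b) :
    MeasurePreserving (fun (ω : ι → E × F) i => ((ω (a i)).1, (ω (b i)).2))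
      (Measure.infinitePi fun _ => μ.prod ν) (Measure.infinitePi fun _ => μ.prod ν) := by
  refine ⟨by fun_prop, ?_⟩
  -- The Boolean records which component is read, so `σ` is injective even if the ranges of `a` and
  -- `b` overlap.
  set σ : κ × Bool → ι × Bool := fun q => (if q.2 then a q.1 else b q.1, q.2) with hσ
  have hinj : Function.Injective σ := by
    rintro ⟨i, x⟩ ⟨j, y⟩ h
    simp only [hσ, Prod.mk.injEq] at h
    obtain ⟨h1, rfl⟩ := h
    cases x
    · simpa using hb (by simpa using h1)
    · simpa using ha (by simpa using h1)
  rw [← map_infinitePi_bool, ← map_infinitePi_bool (ι := κ),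
    ← (measurePreserving_comp_injective (ρ := μ.prod ν) hinj).map_eq,
    Measure.map_map (by fun_prop) (by fun_prop), Measure.map_map (by fun_prop) (by fun_prop)]
  rfl

end InfinitePi

/-! ### The half-line and full-line configurations -/

section Lines

theorem halfLine_pos_succ (ω : ℕ → Mark) (n : ℕ) :
    (halfLine ω).pos (n + 1) = (halfLine ω).pos n + (ω (n + 1)).1 :=
  Finset.sum_range_succ _ _

theorem strictMono_halfLine (ω : ℕ → Mark) : StrictMono (halfLine ω).pos :=
  strictMono_nat_of_lt_succ fun n => by
    rw [halfLine_pos_succ]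
    linarith [(ω (n + 1)).1.2.out]

theorem fullLine_pos_add_one (ω : ℤ → Mark) (n : ℤ) :
    (fullLine ω).pos (n + 1) = (fullLine ω).pos n + (ω (n + 1)).1 := by
  simp only [fullLine]
  rcases le_or_gt 0 n with h | h
  · have h1 : Finset.Ioc 0 (n + 1) = insert (n + 1) (Finset.Ioc 0 n) := by
      ext x; simp only [Finset.mem_Ioc, Finset.mem_insert]; omega
    rw [h1, Finset.sum_insert (by simp), Finset.Ioc_eq_empty (by omega : ¬ n + 1 < 0),
      Finset.Ioc_eq_empty (by omega : ¬ n < 0)]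
    ring
  · have h1 : Finset.Ioc n 0 = insert (n + 1) (Finset.Ioc (n + 1) 0) := by
      ext x; simp only [Finset.mem_Ioc, Finset.mem_insert]; omega
    rw [h1, Finset.sum_insert (by simp), Finset.Ioc_eq_empty (by omega : ¬ 0 < n + 1),
      Finset.Ioc_eq_empty (by omega : ¬ 0 < n)]
    ring

theorem fullLine_pos_sub_one (ω : ℤ → Mark) (n : ℤ) :
    (fullLine ω).pos (n - 1) = (fullLine ω).pos n - (ω n).1 := by
  have := fullLine_pos_add_one ω (n - 1)
  rw [sub_add_cancel] at this
  linarith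

theorem strictMono_fullLine (ω : ℤ → Mark) : StrictMono (fullLine ω).pos :=
  strictMono_int_of_lt_succ fun n => by
    rw [fullLine_pos_add_one]
    linarith [(ω (n + 1)).1.2.out]

theorem isMeasurable_halfLine : Config.IsMeasurable halfLine where
  injective ω := (strictMono_halfLine ω).injective
  pos i := by unfold halfLine; fun_prop
  vel i := by unfold halfLine; fun_prop
  spin i := by unfold halfLine; fun_prop

theorem measurable_halfLine_vel (i : ℕ) : Measurable fun ω => (halfLine ω).vel i :=
  isMeasurable_halfLine.vel i

theorem netCount_eq (k : ℕ) (ω : ℕ → Mark) :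
    netCount k ω = (halfLine ω).netSum (Finset.range k) := by
  classical
  have h : {n | n < k} = (Finset.range k : Set ℕ) := by ext; simp
  refine Finset.sum_congr rfl fun i _ => congrArg₂ _ rfl ?_
  exact if_congr (by rw [h]) rfl rfl

theorem measurable_netCount (k : ℕ) : Measurable (netCount k) := by
  have := isMeasurable_halfLine.measurable_netSum (Finset.range k)
  simpa only [← netCount_eq] using this

theorem abs_netCount_le (k : ℕ) (ω : ℕ → Mark) : |netCount k ω| ≤ k := by
  rw [netCount_eq]
  simpa using (halfLine ω).abs_netSum_le (Finset.range k)

/-- The data seen from the particle with index `s`. -/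
def shift (s : ℕ) (ω : ℕ → Mark) : ℕ → Mark := fun n => ω (n + s)

theorem measurable_shift (s : ℕ) : Measurable (shift s) := by
  unfold shift; fun_prop

theorem similar_shift (s : ℕ) (ω : ℕ → Mark) (S : Set ℕ) :
    (halfLine (shift s ω)).Similar (halfLine ω) S (fun n => n + s)
      (∑ i ∈ Finset.range s, ((ω i).1 : ℝ)) 1 where
  injective := add_left_injective s
  pos i _ := by
    simp only [halfLine, shift, Units.val_one, Int.cast_one, one_mul]
    rw [show i + s + 1 = s + (i + 1) by ring, Finset.sum_range_add]
    simp only [add_comm]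
  vel i _ := by simp [halfLine, shift]
  spin i _ := by simp [halfLine, shift]

theorem Config.Similar.netSum_eq {ι κ : Type*} [DecidableEq κ] {c : Config ι} {c' : Config κ}
    {e : ι → κ} {a : ℝ} {F : Finset ι} (h : c.Similar c' F e a 1) (hc : Function.Injective c.pos)
    (hc' : Function.Injective c'.pos) : c'.netSum (F.image e) = c.netSum F := by
  classical
  unfold netSum
  rw [Finset.sum_image fun x _ y _ hxy => h.injective hxy]
  refine Finset.sum_congr rfl fun i hi => ?_
  have hv : c'.vel (e i) = c.vel i := by
    have h1 := h.vel i hi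
    have h2 : ∀ x y : SignType, (x : ℤ) = y → x = y := by decide
    exact h2 _ _ (by simpa using h1)
  refine congrArg₂ _ (by simp only [charge, hv]) (if_congr ?_ rfl rfl)
  rw [Finset.coe_image, h.survives_iff hc hc']

theorem netSum_Ico (s n : ℕ) (ω : ℕ → Mark) :
    (halfLine ω).netSum (Finset.Ico s (n + s)) = netCount n (shift s ω) := by
  rw [netCount_eq, ← (similar_shift s ω _).netSum_eq (strictMono_halfLine _).injective
    (strictMono_halfLine _).injective]
  congr 1
  ext x
  simp only [Finset.mem_Ico, Finset.mem_image, Finset.mem_range]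
  exact ⟨fun h => ⟨x - s, by omega, by omega⟩, by rintro ⟨y, hy, rfl⟩; omega⟩

/-- Two half-line configurations whose data coincide, except for the location of the first
particle. -/
theorem similar_of_eqOn {ω ω' : ℕ → Mark} {n : ℕ} (h1 : ∀ i < n, (ω i).2 = (ω' i).2)
    (h2 : ∀ i < n, i ≠ 0 → (ω i).1 = (ω' i).1) {S : Set ℕ} (hS : ∀ i ∈ S, i < n) :
    (halfLine ω).Similar (halfLine ω') S id ((ω' 0).1 - (ω 0).1) 1 where
  injective := Function.injective_id
  pos i hi := by
    have hi := hS i hi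
    simp only [halfLine, id, Units.val_one, Int.cast_one, one_mul, Finset.sum_range_succ']
    have h3 : ∑ j ∈ Finset.range i, ((ω (j + 1)).1 : ℝ) = ∑ j ∈ Finset.range i, ((ω' (j + 1)).1 : ℝ) :=
      Finset.sum_congr rfl fun j hj => by
        rw [h2 (j + 1) (by have := Finset.mem_range.1 hj; omega) (by omega)]
    rw [h3]
    ring
  vel i hi := by simp [halfLine, h1 i (hS i hi)]
  spin i hi := by simp [halfLine, h1 i (hS i hi)]

theorem survives_iff_of_eqOn {ω ω' : ℕ → Mark} {n : ℕ} (h1 : ∀ i < n, (ω i).2 = (ω' i).2)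
    (h2 : ∀ i < n, i ≠ 0 → (ω i).1 = (ω' i).1) {S : Set ℕ} (hS : ∀ i ∈ S, i < n) (i : ℕ) :
    (halfLine ω).Survives S i ↔ (halfLine ω').Survives S i := by
  have := (similar_of_eqOn h1 h2 hS).survives_iff (i := i) (strictMono_halfLine _).injective
    (strictMono_halfLine _).injective
  rw [Set.image_id] at this
  exact this.symm

theorem netCount_congr {ω ω' : ℕ → Mark} {n : ℕ} (h : ∀ i < n, ω i = ω' i) :
    netCount n ω = netCount n ω' := by
  have := (similar_of_eqOn (ω := ω) (ω' := ω') (fun i hi => by rw [h i hi])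
    (fun i hi _ => by rw [h i hi]) (S := (Finset.range n : Set ℕ)) (by simp)).netSum_eq (strictMono_halfLine _).injective
    (strictMono_halfLine _).injective
  rw [Finset.image_id] at this
  rw [netCount_eq, netCount_eq, this]

/-- In the half-line process, some left-moving particle among the first `n` ones reaches the
origin. -/
def Hit (n : ℕ) (ω : ℕ → Mark) : Prop :=
  ∃ i < n, (halfLine ω).vel i = -1 ∧ (halfLine ω).Survives (Set.Iic i) i

theorem Hit.mono {m n : ℕ} (hmn : m ≤ n) {ω : ℕ → Mark} (h : Hit m ω) : Hit n ω :=
  h.imp fun _ hi => ⟨hi.1.trans_le hmn, hi.2⟩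

theorem measurable_exit (i : ℕ) : Measurable fun ω : ℕ → Mark =>
    (halfLine ω).vel i = -1 ∧ (halfLine ω).Survives (Set.Iic i) i := by
  refine Measurable.and ?_ (isMeasurable_halfLine.measurable_survives (Set.finite_Iic i) i)
  have h2 : Measurable fun x : SignType => x = -1 := measurable_of_countable _
  exact h2.comp (measurable_halfLine_vel i)

theorem measurable_hit (n : ℕ) : Measurable (Hit n) :=
  Measurable.exists fun i => measurable_const.and (measurable_exit i)

/-- The first gap only translates the configuration. Ignoring it is what makes the left side of the
full line independent of the mark of particle 0. -/
theorem hit_congr {ω ω' : ℕ → Mark} {n : ℕ} (h1 : ∀ i < n, (ω i).2 = (ω' i).2)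
    (h2 : ∀ i < n, i ≠ 0 → (ω i).1 = (ω' i).1) : Hit n ω ↔ Hit n ω' := by
  refine exists_congr fun i => and_congr_right fun hi => and_congr ?_ ?_
  · simp [halfLine, h1 i hi]
  · exact survives_iff_of_eqOn h1 h2 (fun j hj => lt_of_le_of_lt hj hi) i

end Lines

end BallisticAnnihilation

namespace BallisticAnnihilation

/-! ### The count of the half-line process with positive drift -/

section Drift

/-- Exponential tilting of a bounded integer-valued law with positive mean. -/
theorem exists_sum_mul_exp_le_one {k : ℕ} (q : ℤ → ℝ) (hq : ∀ v, 0 ≤ q v)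
    (hsum : ∑ v ∈ Finset.Icc (-k : ℤ) k, q v = 1)
    (hmean : 0 < ∑ v ∈ Finset.Icc (-k : ℤ) k, q v * v) :
    ∃ s : ℝ, 0 < s ∧ ∑ v ∈ Finset.Icc (-k : ℤ) k, q v * Real.exp (-s * v) ≤ 1 := by
  set M := ∑ v ∈ Finset.Icc (-k : ℤ) k, q v * v with hM
  have habs : ∀ v ∈ Finset.Icc (-k : ℤ) k, |(v : ℝ)| ≤ k := by
    intro v hv
    rw [Finset.mem_Icc] at hv
    rw [abs_le]
    exact ⟨by exact_mod_cast hv.1, by exact_mod_cast hv.2⟩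
  have hMk : M ≤ k := by
    calc M ≤ ∑ v ∈ Finset.Icc (-k : ℤ) k, q v * k :=
          Finset.sum_le_sum fun v hv =>
            mul_le_mul_of_nonneg_left ((le_abs_self _).trans (habs v hv)) (hq v)
      _ = k := by rw [← Finset.sum_mul, hsum, one_mul]
  have hk : (0 : ℝ) < k := hmean.trans_le hMk
  -- From $e^{-y}\le 1-y+y^2$ for $|y|\le1$, the tilted sum is at most $1-sM+s^2k^2$, which equals 1
  -- for this $s$; and $sk\le1$ because $M\le k$.
  refine ⟨M / k ^ 2, by positivity, ?_⟩
  set s := M / (k : ℝ) ^ 2 with hs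
  have hs0 : 0 < s := by positivity
  have hsk : s * k ^ 2 = M := by rw [hs]; field_simp
  calc ∑ v ∈ Finset.Icc (-k : ℤ) k, q v * Real.exp (-s * v)
      ≤ ∑ v ∈ Finset.Icc (-k : ℤ) k, (q v * (1 + s ^ 2 * k ^ 2) - s * (q v * v)) := by
        refine Finset.sum_le_sum fun v hv => ?_
        have h1 := habs v hv
        have h2 : |(-s * v : ℝ)| ≤ 1 := by
          rw [abs_mul, abs_neg, abs_of_pos hs0]
          have : s * k ≤ 1 := by
            have : s * k * k ≤ 1 * k := by nlinarith
            exact le_of_mul_le_mul_right this hk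
          nlinarith
        have h3 := (abs_le.1 (Real.abs_exp_sub_one_sub_id_le h2)).2
        have h4 : (v : ℝ) ^ 2 ≤ k ^ 2 := sq_le_sq' (abs_le.1 h1).1 (abs_le.1 h1).2
        have h5 : Real.exp (-s * v) ≤ 1 + s ^ 2 * k ^ 2 - s * v := by nlinarith [sq_nonneg s]
        have := mul_le_mul_of_nonneg_left h5 (hq v)
        linarith
    _ = 1 + s * (s * k ^ 2) - s * M := by
        rw [Finset.sum_sub_distrib, ← Finset.sum_mul, hsum, ← Finset.mul_sum, ← hM]
        ring
    _ = 1 := by rw [hsk]; ring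
    _ ≤ 1 := le_rfl

/-- The first `s ≥ k` particles have no surviving right-moving particle, and a count at least that
of the first `k` ones. -/
def Split (k s : ℕ) (ω : ℕ → Mark) : Prop :=
  k ≤ s ∧ (∀ j < s, (halfLine ω).vel j = 1 → ¬ (halfLine ω).Survives (Finset.range s) j) ∧
    netCount k ω ≤ netCount s ω

theorem measurable_split (k s : ℕ) : Measurable (Split k s) := by
  refine measurable_const.and (Measurable.and (Measurable.forall fun j => measurable_const.imp
    (Measurable.imp ?_
      (isMeasurable_halfLine.measurable_survives (Finset.finite_toSet _) j).not)) ?_)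
  · have h2 : Measurable fun x : SignType => x = 1 := measurable_of_countable _
    exact h2.comp (measurable_halfLine_vel j)
  · exact measurableSet_setOfPred.1 (measurableSet_le (measurable_netCount k) (measurable_netCount s))

theorem split_congr {k s : ℕ} {ω ω' : ℕ → Mark} (h : ∀ i < s, ω i = ω' i) :
    Split k s ω ↔ Split k s ω' := by
  refine and_congr_right fun hks => and_congr ?_ ?_
  · refine forall_congr' fun j => imp_congr_right fun hj => imp_congr ?_ (not_congr ?_)
    · simp [halfLine, h j hj]
    · exact survives_iff_of_eqOn (fun i hi => by rw [h i hi]) (fun i hi _ => by rw [h i hi])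
        (by simp) j
  · rw [netCount_congr fun i hi => h i (lt_of_lt_of_le hi hks), netCount_congr h]

/-- The data splits at `s`, and not before. -/
def FirstSplit (k s : ℕ) (ω : ℕ → Mark) : Prop := Split k s ω ∧ ∀ r < s, ¬ Split k r ω

theorem measurable_firstSplit (k s : ℕ) : Measurable (FirstSplit k s) :=
  (measurable_split k s).and (Measurable.forall fun r =>
    measurable_const.imp (measurable_split k r).not)

theorem firstSplit_congr {k s : ℕ} {ω ω' : ℕ → Mark} (h : ∀ i < s, ω i = ω' i) :
    FirstSplit k s ω ↔ FirstSplit k s ω' :=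
  and_congr (split_congr h) (forall_congr' fun _ => imp_congr_right fun hr =>
    not_congr (split_congr fun i hi => h i (hi.trans hr)))

/-- The count reaches `-x` within the first `n` particles. -/
def Ruin (n : ℕ) (x : ℤ) (ω : ℕ → Mark) : Prop := ∃ i ≤ n, netCount i ω ≤ -x

theorem measurable_ruin (n : ℕ) (x : ℤ) : Measurable (Ruin n x) :=
  Measurable.exists fun i => measurable_const.and
    (measurableSet_setOfPred.1 (measurableSet_le (measurable_netCount i) measurable_const))

theorem ruin_shift_congr {n r : ℕ} {x : ℤ} {ω ω' : ℕ → Mark}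
    (h : ∀ i ∈ Finset.Ico r (n + r), ω i = ω' i) : Ruin n x (shift r ω) ↔ Ruin n x (shift r ω') := by
  refine exists_congr fun i => and_congr_right fun hi => ?_
  have : netCount i (shift r ω) = netCount i (shift r ω') :=
    netCount_congr fun j hj => h (j + r) (Finset.mem_Ico.2 ⟨by omega, by omega⟩)
  rw [this]

theorem netCount_add_le {s i : ℕ} (hsi : s ≤ i) {ω : ℕ → Mark} (h : ∀ j < s,
    (halfLine ω).vel j = 1 → ¬ (halfLine ω).Survives (Finset.range s) j) :
    netCount s ω + netCount (i - s) (shift s ω) ≤ netCount i ω := by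
  rw [netCount_eq s, netCount_eq i, ← netSum_Ico, Nat.sub_add_cancel hsi]
  have := Config.netSum_union_le (strictMono_halfLine ω) (A := Finset.range s)
    (B := Finset.Ico s i) (fun a ha b hb => (Finset.mem_range.1 ha).trans_le (Finset.mem_Ico.1 hb).1)
    fun j hj => h j (Finset.mem_range.1 hj)
  convert this using 2
  ext x
  simp only [Finset.mem_range, Finset.mem_union, Finset.mem_Ico]
  omega

/-- Reaching `-x < -k` forces a split `s` beforehand. The count at `s` is at least `netCount k ω`,
so by superadditivity the process restarted at `s` must make up the difference. -/
theorem exists_firstSplit {k n : ℕ} {x : ℤ} (hx : k < x) {ω : ℕ → Mark} (h : Ruin n x ω) :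
    ∃ s, k ≤ s ∧ s ≤ n ∧ FirstSplit k s ω ∧ Ruin (n - s) (x + netCount k ω) (shift s ω) := by
  obtain ⟨i, hin, hi⟩ := h
  have hex : ∃ s, Split k s ω ∧ s ≤ i := by
    have h1 : (halfLine ω).netSum (Finset.range i) < -k := by rw [← netCount_eq]; omega
    obtain ⟨s, hks, hsi, h2, h3⟩ := Config.exists_split (strictMono_halfLine ω) h1
    exact ⟨s, ⟨hks, h2, by rwa [netCount_eq, netCount_eq]⟩, hsi⟩
  classical
  obtain ⟨hs, hsi⟩ := Nat.find_spec hex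
  have hmin := fun r (hr : r < Nat.find hex) => Nat.find_min hex hr
  generalize Nat.find hex = s at hs hsi hmin
  refine ⟨s, hs.1, hsi.trans hin, ⟨hs, fun r hr hr' => hmin r hr ⟨hr', by omega⟩⟩, i - s,
    by omega, ?_⟩
  have h4 := netCount_add_le hsi hs.2.1
  have h5 := hs.2.2
  omega

variable {ρ : Measure Mark} [IsProbabilityMeasure ρ]

/-- A Cramér–Lundberg bound: condition on the value `v` of the first count and on the first split
`r`. The process after `r` is a fresh copy that has to fall by `x + v`; the induction hypothesis
bounds this, and the tilting hypothesis closes the recursion. The shift by `k` in the exponent pays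
for levels above `-k`, where no split is guaranteed. -/
theorem measureReal_ruin_le {k : ℕ} (hk : 1 ≤ k) {s : ℝ} (hs : 0 ≤ s)
    (h : ∑ v ∈ Finset.Icc (-k : ℤ) k,
      (Measure.infinitePi fun _ : ℕ => ρ).real {ω | netCount k ω = v} * Real.exp (-s * v) ≤ 1)
    (n : ℕ) (x : ℤ) :
    (Measure.infinitePi fun _ : ℕ => ρ).real {ω | Ruin n x ω} ≤ Real.exp (-s * (x - k)) := by
  set P := Measure.infinitePi fun _ : ℕ => ρ with hP
  induction n using Nat.strong_induction_on generalizing x with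
  | _ n ih =>
  -- For `x ≤ k` the bound is at least 1.
  rcases le_or_gt x k with hx | hx
  · refine measureReal_le_one.trans (Real.one_le_exp ?_)
    have : (x : ℝ) ≤ k := by exact_mod_cast hx
    nlinarith
  set D : ℕ → ℤ → Set (ℕ → Mark) := fun r v => {ω | FirstSplit k r ω ∧ netCount k ω = v} with hD
  have hDm : ∀ r v, MeasurableSet (D r v) := fun r v =>
    measurableSet_setOfPred.2 ((measurable_firstSplit k r).and
      (measurableSet_setOfPred.1 (measurableSet_eq_fun (measurable_netCount k) measurable_const)))
  have hRm : ∀ n x, MeasurableSet {ω | Ruin n x ω} := fun n x =>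
    measurableSet_setOfPred.2 (measurable_ruin n x)
  have hsub : {ω | Ruin n x ω} ⊆ ⋃ v ∈ Finset.Icc (-k : ℤ) k, ⋃ r ∈ Finset.Icc k n,
      (D r v ∩ shift r ⁻¹' {ω | Ruin (n - r) (x + v) ω}) := by
    intro ω hω
    obtain ⟨r, h1, h2, h3, h4⟩ := exists_firstSplit hx hω
    have h5 := abs_le.1 (abs_netCount_le k ω)
    simp only [Set.mem_iUnion]
    exact ⟨netCount k ω, Finset.mem_Icc.2 h5, r, Finset.mem_Icc.2 ⟨h1, h2⟩, ⟨h3, rfl⟩, h4⟩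
  have hterm : ∀ v, ∀ r ∈ Finset.Icc k n,
      P.real (D r v ∩ shift r ⁻¹' {ω | Ruin (n - r) (x + v) ω}) ≤
        P.real (D r v) * Real.exp (-s * (x + v - k)) := by
    intro v r hr
    rw [Finset.mem_Icc] at hr
    have hind : P (D r v ∩ shift r ⁻¹' {ω | Ruin (n - r) (x + v) ω}) =
        P (D r v) * P (shift r ⁻¹' {ω | Ruin (n - r) (x + v) ω}) := by
      refine infinitePi_inter_of_disjoint (s := Finset.range r) (t := Finset.Ico r n) ?_ (hDm r v)
        (measurable_shift r (hRm _ _)) ?_ ?_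
      · refine Finset.disjoint_left.2 fun i hi hi' => ?_
        rw [Finset.mem_range] at hi
        rw [Finset.mem_Ico] at hi'
        omega
      · intro ω ω' hω
        have hω' : ∀ i < r, ω i = ω' i := fun i hi => hω i (Finset.mem_range.2 hi)
        refine and_congr (firstSplit_congr hω') ?_
        rw [netCount_congr fun i hi => hω' i (hi.trans_le hr.1)]
      · intro ω ω' hω
        exact ruin_shift_congr fun i hi => hω i (by rwa [Nat.sub_add_cancel hr.2] at hi)
    have hshift : P (shift r ⁻¹' {ω | Ruin (n - r) (x + v) ω}) =
        P {ω | Ruin (n - r) (x + v) ω} :=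
      (measurePreserving_comp_injective (ρ := ρ) (add_left_injective r)).measure_preimage
        (hRm _ _).nullMeasurableSet
    rw [measureReal_def, hind, ENNReal.toReal_mul, hshift]
    refine mul_le_mul_of_nonneg_left ?_ ENNReal.toReal_nonneg
    have := ih (n - r) (by omega) (x + v)
    push_cast at this
    exact this
  calc P.real {ω | Ruin n x ω}
      ≤ P.real (⋃ v ∈ Finset.Icc (-k : ℤ) k, ⋃ r ∈ Finset.Icc k n,
          (D r v ∩ shift r ⁻¹' {ω | Ruin (n - r) (x + v) ω})) :=
        measureReal_mono hsub (measure_ne_top _ _)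
    _ ≤ ∑ v ∈ Finset.Icc (-k : ℤ) k, ∑ r ∈ Finset.Icc k n,
          P.real (D r v ∩ shift r ⁻¹' {ω | Ruin (n - r) (x + v) ω}) :=
        (measureReal_biUnion_finset_le _ _).trans
          (Finset.sum_le_sum fun v _ => measureReal_biUnion_finset_le _ _)
    _ ≤ ∑ v ∈ Finset.Icc (-k : ℤ) k, ∑ r ∈ Finset.Icc k n,
          P.real (D r v) * Real.exp (-s * (x + v - k)) :=
        Finset.sum_le_sum fun v _ => Finset.sum_le_sum fun r hr => hterm v r hr
    _ ≤ ∑ v ∈ Finset.Icc (-k : ℤ) k,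
          P.real {ω | netCount k ω = v} * Real.exp (-s * (x + v - k)) := by
        refine Finset.sum_le_sum fun v _ => ?_
        rw [← Finset.sum_mul]
        refine mul_le_mul_of_nonneg_right ?_ (Real.exp_nonneg _)
        -- First splits at different `r` exclude each other, so their probabilities add up to at
        -- most that of the value `v`; a split need not occur almost surely.
        rw [← measureReal_biUnion_finset ?_ fun r _ => hDm r v]
        · refine measureReal_mono ?_
          intro ω hω
          simp only [Set.mem_iUnion] at hω
          obtain ⟨r, -, hr⟩ := hω
          exact hr.2
        · intro r _ r' _ hne
          refine Set.disjoint_left.2 fun ω h1 h2 => ?_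
          rcases lt_or_gt_of_ne hne with hlt | hlt
          · exact h2.1.2 r hlt h1.1.1
          · exact h1.1.2 r' hlt h2.1.1
    _ = Real.exp (-s * (x - k)) * ∑ v ∈ Finset.Icc (-k : ℤ) k,
          P.real {ω | netCount k ω = v} * Real.exp (-s * v) := by
        rw [Finset.mul_sum]
        refine Finset.sum_congr rfl fun v _ => ?_
        rw [mul_left_comm, ← Real.exp_add]
        congr 2
        ring
    _ ≤ Real.exp (-s * (x - k)) := mul_le_of_le_one_right (Real.exp_nonneg _) h

theorem exists_tilt {k : ℕ}
    (h : 0 < ∫ ω, (netCount k ω : ℝ) ∂(Measure.infinitePi fun _ : ℕ => ρ)) :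
    ∃ s : ℝ, 0 < s ∧ ∑ v ∈ Finset.Icc (-k : ℤ) k,
      (Measure.infinitePi fun _ : ℕ => ρ).real {ω | netCount k ω = v} * Real.exp (-s * v) ≤ 1 := by
  set P := Measure.infinitePi fun _ : ℕ => ρ with hP
  have hm : ∀ v : ℤ, MeasurableSet {ω | netCount k ω = v} := fun v =>
    measurableSet_eq_fun (measurable_netCount k) measurable_const
  have hmem : ∀ ω, netCount k ω ∈ Finset.Icc (-k : ℤ) k := fun ω =>
    Finset.mem_Icc.2 (abs_le.1 (abs_netCount_le k ω))
  have key : ∀ f : ℤ → ℝ, ∫ ω, f (netCount k ω) ∂P =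
      ∑ v ∈ Finset.Icc (-k : ℤ) k, P.real {ω | netCount k ω = v} * f v := by
    intro f
    have h1 : ∀ ω, f (netCount k ω) = ∑ v ∈ Finset.Icc (-k : ℤ) k,
        {ω | netCount k ω = v}.indicator (fun _ => f v) ω := by
      intro ω
      rw [Finset.sum_eq_single (netCount k ω)]
      · simp
      · intro v _ hv
        exact Set.indicator_of_notMem (fun h => hv h.symm) _
      · intro h; exact absurd (hmem ω) h
    simp_rw [h1]
    rw [integral_finsetSum _ fun v _ => (integrable_const _).indicator (hm v)]
    refine Finset.sum_congr rfl fun v _ => ?_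
    rw [integral_indicator_const _ (hm v), smul_eq_mul]
  refine exists_sum_mul_exp_le_one _ (fun v => measureReal_nonneg) ?_ ?_
  · have := key fun _ => 1
    simpa using this.symm
  · rwa [← key fun v => (v : ℝ)]

theorem netCount_of_static {k : ℕ} {ω : ℕ → Mark} (h : ∀ i < k, (halfLine ω).vel i = 0) :
    (∀ i < k, (halfLine ω).Survives (Finset.range k) i) ∧ netCount k ω = k := by
  have hs : ∀ i < k, (halfLine ω).Survives (Finset.range k) i := by
    intro i hi
    rw [Config.survives_iff]
    refine ⟨by simpa using hi, fun j hj => ?_⟩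
    have hjk : j < k := by simpa using hj.mem_right
    exact hj.vel_ne (strictMono_halfLine ω) ((h i hi).trans (h j hjk).symm)
  refine ⟨hs, ?_⟩
  classical
  rw [netCount_eq, Config.netSum, Finset.sum_congr rfl (g := fun _ => 1), Finset.sum_const,
    Finset.card_range, nsmul_eq_mul, mul_one]
  intro i hi
  have hi := Finset.mem_range.1 hi
  rw [if_pos (hs i hi)]
  simp [Config.charge, h i hi]

/-- The static particles provide a credit of `k`. At the time of a hit the total count is negative,
so the shifted count would be at most `-(k + 1)`. -/
theorem not_hit_of_static {k n : ℕ} {ω : ℕ → Mark} (h : ∀ i < k, (halfLine ω).vel i = 0)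
    (hr : ¬ Ruin n (k + 1) (shift k ω)) : ¬ Hit (n + k) ω := by
  rintro ⟨i, hi, hv, hs⟩
  have hki : k ≤ i := by
    by_contra! hik
    rw [h i hik] at hv
    exact absurd hv (by decide)
  have hset : Set.Iic i = (Finset.range (i + 1) : Set ℕ) := by
    ext x; simp
  rw [hset] at hs
  have h1 := hs.netSum_lt_zero (strictMono_halfLine ω) hv fun j hj => by
    have := Finset.mem_range.1 hj; omega
  rw [← netCount_eq] at h1
  obtain ⟨h2, h3⟩ := netCount_of_static h
  have h4 := netCount_add_le (s := k) (i := i + 1) (by omega) (ω := ω) fun j hj hvj => by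
    rw [h j hj] at hvj
    exact absurd hvj (by decide)
  exact hr ⟨i + 1 - k, by omega, by omega⟩

/-- If some count has positive mean, then with positive probability no particle reaches the origin
in the half-line process. -/
theorem exists_le_measureReal_not_hit {k : ℕ} (hk : 1 ≤ k)
    (hρ : 0 < ρ {x | x.2.1 = 0})
    (h : 0 < ∫ ω, (netCount k ω : ℝ) ∂(Measure.infinitePi fun _ : ℕ => ρ)) :
    ∃ δ : ℝ, 0 < δ ∧ ∀ n, δ ≤ (Measure.infinitePi fun _ : ℕ => ρ).real {ω | ¬ Hit n ω} := by
  set P := Measure.infinitePi fun _ : ℕ => ρ with hP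
  obtain ⟨s, hs, hsum⟩ := exists_tilt h
  have hvm : MeasurableSet {x : Mark | x.2.1 = 0} :=
    measurableSet_eq_fun (by fun_prop) measurable_const
  set A : Set (ℕ → Mark) := (Finset.range k : Set ℕ).pi fun _ => {x : Mark | x.2.1 = 0} with hA
  have hAm : MeasurableSet A := MeasurableSet.pi (Finset.countable_toSet _) fun _ _ => hvm
  have hPA : P A = ρ {x | x.2.1 = 0} ^ k := by
    rw [hA, hP, Measure.infinitePi_pi (μ := fun _ : ℕ => ρ) fun _ _ => hvm]
    simp
  have hq : 0 < (ρ {x | x.2.1 = 0}).toReal := ENNReal.toReal_pos hρ.ne' (measure_ne_top _ _)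
  -- The first factor is the probability of `k` initial static particles; the second bounds from
  -- below the probability that the rest never reaches `-(k + 1)`, the ruin bound being `exp (-s *
  -- ((k + 1) - k))`.
  refine ⟨(ρ {x | x.2.1 = 0}).toReal ^ k * (1 - Real.exp (-s)), ?_, fun n => ?_⟩
  · have : Real.exp (-s) < 1 := Real.exp_zero ▸ Real.exp_lt_exp.2 (by linarith)
    exact mul_pos (pow_pos hq k) (by linarith)
  have hRm : MeasurableSet {ω | ¬ Ruin n (k + 1) ω} :=
    measurableSet_setOfPred.2 (measurable_ruin n _).not
  have hruin := measureReal_ruin_le hk hs.le hsum n (k + 1)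
  have hcompl : P.real {ω | ¬ Ruin n (k + 1) ω} = 1 - P.real {ω | Ruin n (k + 1) ω} :=
    probReal_compl_eq_one_sub (measurableSet_setOfPred.2 (measurable_ruin n _))
  have hind : P (A ∩ shift k ⁻¹' {ω | ¬ Ruin n (k + 1) ω}) =
      P A * P (shift k ⁻¹' {ω | ¬ Ruin n (k + 1) ω}) := by
    refine infinitePi_inter_of_disjoint (s := Finset.range k) (t := Finset.Ico k (n + k)) ?_ hAm
      (measurable_shift k hRm) ?_ ?_
    · refine Finset.disjoint_left.2 fun i hi hi' => ?_
      rw [Finset.mem_range] at hi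
      rw [Finset.mem_Ico] at hi'
      omega
    · intro ω ω' hω
      refine forall_congr' fun i => imp_congr_right fun hi => ?_
      rw [hω i (Finset.mem_coe.1 hi)]
    · exact fun ω ω' hω => not_congr (ruin_shift_congr hω)
  have hshift : P (shift k ⁻¹' {ω | ¬ Ruin n (k + 1) ω}) = P {ω | ¬ Ruin n (k + 1) ω} :=
    (measurePreserving_comp_injective (ρ := ρ) (add_left_injective k)).measure_preimage
      hRm.nullMeasurableSet
  have hsub : A ∩ shift k ⁻¹' {ω | ¬ Ruin n (k + 1) ω} ⊆ {ω | ¬ Hit n ω} := by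
    rintro ω ⟨h1, h2⟩ h3
    exact not_hit_of_static (fun i hi => h1 i (by simpa using hi)) h2 (h3.mono (by omega))
  refine le_trans ?_ (measureReal_mono hsub)
  rw [measureReal_def, hind, hPA, hshift, ENNReal.toReal_mul, ENNReal.toReal_pow,
    ← measureReal_def P, hcompl]
  refine mul_le_mul_of_nonneg_left ?_ (pow_nonneg hq.le k)
  have h6 : (-s * (((k + 1 : ℤ) : ℝ) - k) : ℝ) = -s := by push_cast; ring
  rw [h6] at hruin
  linarith

end Drift

end BallisticAnnihilation

namespace BallisticAnnihilation

/-! ### Both sides of a static particle of the full line -/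

section FullLine

/-- The data of the particles with index at least `k`. -/
def window (k : ℤ) (ω : ℤ → Mark) : ℕ → Mark := fun n => ω (n + k)

/-- The data of the particles with negative index, in the mirror image of the line. -/
def leftData (ω : ℤ → Mark) : ℕ → Mark :=
  fun n => ((ω (-n)).1, -(ω (-1 - n)).2.1, -(ω (-1 - n)).2.2)

theorem similar_window (k : ℤ) (ω : ℤ → Mark) (S : Set ℕ) :
    (halfLine (window k ω)).Similar (fullLine ω) S (fun n => (n : ℤ) + k)
      ((fullLine ω).pos k - (ω k).1) 1 where
  injective i j h := by simpa using h
  pos i hi := by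
    clear hi
    simp only [Units.val_one, Int.cast_one, one_mul]
    induction i with
    | zero => simp [halfLine, window]
    | succ i ih =>
      rw [halfLine_pos_succ, show ((i + 1 : ℕ) : ℤ) + k = (i + k) + 1 by push_cast; ring,
        fullLine_pos_add_one, ih]
      simp only [window]
      rw [show ((i + 1 : ℕ) : ℤ) + k = (i + k) + 1 by push_cast; ring]
      ring
  vel i _ := by simp [halfLine, fullLine, window]
  spin i _ := by simp [halfLine, fullLine, window]

theorem similar_leftData (ω : ℤ → Mark) (S : Set ℕ) :
    (halfLine (leftData ω)).Similar (fullLine ω) S (fun n => -1 - (n : ℤ)) 0 (-1) where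
  injective i j h := by simpa using h
  pos i hi := by
    clear hi
    simp only [Units.val_neg, Units.val_one, Int.cast_neg, Int.cast_one, zero_add, neg_one_mul]
    induction i with
    | zero =>
      have := fullLine_pos_sub_one ω 0
      have h0 : (fullLine ω).pos 0 = 0 := by simp [fullLine]
      simp only [halfLine, leftData]
      simp only [zero_sub] at this
      simp [this, h0]
    | succ i ih =>
      rw [halfLine_pos_succ, show -1 - ((i + 1 : ℕ) : ℤ) = (-1 - i) - 1 by push_cast; ring,
        fullLine_pos_sub_one, ih]
      simp only [leftData]
      rw [show -((i + 1 : ℕ) : ℤ) = -1 - i by push_cast; ring]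
      ring
  vel i _ := by
    show ((ω (-1 - i)).2.1 : ℤ) = _ * ((-(ω (-1 - i)).2.1 : SignType) : ℤ)
    generalize (ω (-1 - i)).2.1 = v
    revert v; decide
  spin i _ := by simp [halfLine, fullLine, leftData]

/-- The particle annihilating 0 would survive in the process on its own side up to itself, and so
produce a hit. Only finite windows intervene, so local finiteness is not needed here. -/
theorem survives_of_not_hit {ω : ℤ → Mark} (h0 : (fullLine ω).vel 0 = 0)
    (hr : ∀ n, ¬ Hit n (window 1 ω)) (hl : ∀ n, ¬ Hit n (leftData ω)) :
    (fullLine ω).Survives Set.univ 0 := by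
  have hc := strictMono_fullLine ω
  rw [Config.survives_iff]
  refine ⟨trivial, fun j hj => ?_⟩
  rcases lt_or_gt_of_ne hj.ne with hlt | hlt
  · have hv : (fullLine ω).vel j = -1 := by
      have := hj.vel_lt hc hlt
      rcases Config.vel_cases (fullLine ω) j with h' | h' | h'
      · exact h'
      · rw [h0, h'] at this; norm_num at this
      · rw [h0, h'] at this; norm_num at this
    have hs := hj.symm.survives_Ioc hc (Set.toFinite _) hlt hv
    obtain ⟨n, rfl⟩ : ∃ n : ℕ, j = n + 1 := ⟨(j - 1).toNat, by omega⟩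
    refine hr (n + 1) ⟨n, by omega, hv, ?_⟩
    rw [← (similar_window 1 ω _).survives_iff (strictMono_halfLine _).injective hc.injective]
    convert hs using 1
    ext x
    simp only [Set.mem_image, Set.mem_Iic, Set.univ_inter, Set.mem_Ioc]
    exact ⟨by rintro ⟨y, hy, rfl⟩; omega, fun hx => ⟨(x - 1).toNat, by omega, by omega⟩⟩
  · have hv : (fullLine ω).vel j = 1 := by
      have := hj.symm.vel_lt hc hlt
      rcases Config.vel_cases (fullLine ω) j with h' | h' | h'
      · rw [h0, h'] at this; norm_num at this
      · rw [h0, h'] at this; norm_num at this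
      · exact h'
    have hs := hj.symm.survives_Ico hc (Set.toFinite _) hlt hv
    obtain ⟨n, rfl⟩ : ∃ n : ℕ, j = -1 - n := ⟨(-1 - j).toNat, by omega⟩
    refine hl (n + 1) ⟨n, by omega, ?_, ?_⟩
    · have hv' : (ω (-1 - n)).2.1 = 1 := hv
      simp [halfLine, leftData, hv']
    rw [← (similar_leftData ω _).survives_iff (strictMono_halfLine _).injective hc.injective]
    convert hs using 1
    ext x
    simp only [Set.mem_image, Set.mem_Iic, Set.univ_inter, Set.mem_Ico]
    exact ⟨by rintro ⟨y, hy, rfl⟩; omega, fun hx => ⟨(-1 - x).toNat, by omega, by omega⟩⟩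

/-- In the window `[0, i + 1]` particle 0 still survives and cuts off its right side. A hit would
then leave a left-moving survivor to the right of a static one, and these would meet. -/
theorem not_hit_of_survives {ω : ℤ → Mark} (hLF : (fullLine ω).LocallyFinite Set.univ)
    (h0 : (fullLine ω).vel 0 = 0) (hs : (fullLine ω).Survives Set.univ 0) (n : ℕ) :
    ¬ Hit n (window 1 ω) := by
  rintro ⟨i, -, hv, hi⟩
  have hc := strictMono_fullLine ω
  rw [← (similar_window 1 ω _).survives_iff (strictMono_halfLine _).injective hc.injective] at hi
  have hv' : (fullLine ω).vel ((i : ℤ) + 1) = -1 := hv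
  have h1 := Config.Survives.inter_Icc (a := 0) (b := (i : ℤ) + 1) hc hLF hs h0 le_rfl (by omega)
  have hLF' := hLF.mono (Set.inter_subset_left (s := Set.univ) (t := Set.Icc (0 : ℤ) (i + 1)))
  have hset : (fun n : ℕ => (n : ℤ) + 1) '' Set.Iic i =
      Set.univ ∩ Set.Icc (0 : ℤ) (i + 1) ∩ Set.Ioi 0 := by
    ext x
    simp only [Set.mem_image, Set.mem_Iic, Set.univ_inter, Set.mem_Icc, Set.mem_inter_iff,
      Set.mem_Ioi]
    exact ⟨by rintro ⟨y, hy, rfl⟩; omega, fun hx => ⟨(x - 1).toNat, by omega, by omega⟩⟩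
  rw [hset] at hi
  have h2 := ((h1.closed_Ioi hc).survives_iff hc.injective hLF' hi.1).1 hi
  have h3 := h1.vel_eq_neg_one hc hLF' h2 (by omega) hv'
  rw [h0] at h3
  exact absurd h3 (by decide)

variable {m : Measure (Set.Ioi (0 : ℝ))} [IsProbabilityMeasure m] {p : ℝ}

theorem measurePreserving_window (k : ℤ) (hp : p ∈ Set.Icc (0 : ℝ) 1) :
    MeasurePreserving (window k) (fullLineLaw m p) (halfLineLaw m p) := by
  have := isProbabilityMeasure_markLaw m hp
  exact measurePreserving_comp_injective (ρ := markLaw m p) (f := fun n : ℕ => (n : ℤ) + k)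
    fun i j h => by simpa using h

theorem map_neg_velocityLaw (p : ℝ) : (velocityLaw p).map (fun v => -v) = velocityLaw p := by
  have hm : Measurable fun v : SignType => -v := measurable_of_countable _
  simp only [velocityLaw]
  rw [Measure.map_add _ _ hm, Measure.map_add _ _ hm]
  simp only [Measure.map_smul, Measure.map_dirac' hm, neg_neg]
  rw [add_assoc, add_assoc, add_comm (ENNReal.ofReal ((1 - p) / 2) • Measure.dirac (-1))]
  rfl

theorem map_neg_spinLaw : spinLaw.map (fun v => -v) = spinLaw := by
  have hm : Measurable fun v : ℤˣ => -v := measurable_of_countable _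
  simp only [spinLaw]
  rw [Measure.map_add _ _ hm]
  simp only [Measure.map_smul, Measure.map_dirac' hm, neg_neg]
  rw [add_comm]

theorem measurePreserving_leftData (hp : p ∈ Set.Icc (0 : ℝ) 1) :
    MeasurePreserving leftData (fullLineLaw m p) (halfLineLaw m p) := by
  have := isProbabilityMeasure_markLaw m hp
  have := isProbabilityMeasure_velocityLaw hp
  have h1 := measurePreserving_shuffle (μ := m) (ν := (velocityLaw p).prod spinLaw)
    (a := fun n : ℕ => -(n : ℤ)) (b := fun n : ℕ => -1 - (n : ℤ))
    (fun i j h => by simpa using h) (fun i j h => by simpa using h)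
  have hmv : Measurable fun v : SignType => -v := measurable_of_countable _
  have hms : Measurable fun v : ℤˣ => -v := measurable_of_countable _
  have hf : Measurable fun x : Mark => (x.1, -x.2.1, -x.2.2) :=
    measurable_fst.prodMk ((hmv.comp (measurable_fst.comp measurable_snd)).prodMk
      (hms.comp (measurable_snd.comp measurable_snd)))
  have h2 := Measure.infinitePi_map_pi (fun _ : ℕ => markLaw m p)
    (f := fun _ x => (x.1, -x.2.1, -x.2.2)) fun _ => hf
  have h3 : (markLaw m p).map (fun x : Mark => (x.1, -x.2.1, -x.2.2)) = markLaw m p := by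
    have h4 : (fun x : Mark => (x.1, -x.2.1, -x.2.2)) =
      Prod.map id (Prod.map (fun v => -v) (fun v => -v)) := rfl
    unfold markLaw
    rw [h4, ← Measure.map_prod_map _ _ measurable_id (hmv.prodMap hms),
      ← Measure.map_prod_map _ _ hmv hms, map_neg_velocityLaw, map_neg_spinLaw, Measure.map_id]
  rw [h3] at h2
  have h5 : MeasurePreserving (fun (x : ℕ → Mark) i => (((x i).1, -(x i).2.1, -(x i).2.2) : Mark))
      (halfLineLaw m p) (halfLineLaw m p) :=
    ⟨measurable_pi_lambda _ fun i => hf.comp (measurable_pi_apply i), h2⟩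
  exact h5.comp h1

theorem markLaw_static (hp : p ∈ Set.Icc (0 : ℝ) 1) :
    markLaw m p {x | x.2.1 = 0} = ENNReal.ofReal p := by
  have := isProbabilityMeasure_velocityLaw hp
  have h1 : {x : Mark | x.2.1 = 0} = Set.univ ×ˢ ({0} ×ˢ Set.univ) := by
    ext x; simp
  rw [markLaw, h1, Measure.prod_prod, Measure.prod_prod]
  simp [velocityLaw]

/-- Valid without measurability of survival on the full line, an event that is only ever compared,
by inclusion, with measurable ones. -/
theorem theta_pos_iff (m : Measure (Set.Ioi (0 : ℝ))) [IsProbabilityMeasure m]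
    (hp : p ∈ Set.Icc (0 : ℝ) 1) : 0 < theta m p ↔ 0 < fullLineLaw m p
      ({ω | (fullLine ω).vel 0 = 0} ∩ {ω | (fullLine ω).Survives Set.univ 0}) := by
  have := isProbabilityMeasure_markLaw m hp
  have : IsProbabilityMeasure (fullLineLaw m p) := by unfold fullLineLaw; infer_instance
  have hmeas : MeasurableSet {ω : ℤ → Mark | (fullLine ω).vel 0 = 0} :=
    measurableSet_eq_fun (by unfold fullLine; fun_prop) measurable_const
  rw [theta, measureReal_def, cond_apply hmeas, ENNReal.toReal_pos_iff]
  constructor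
  · rintro ⟨h, -⟩
    exact pos_of_ne_zero fun h0 => by simp [h0] at h
  · intro h
    have h1 : fullLineLaw m p {ω | (fullLine ω).vel 0 = 0} ≠ 0 := fun h0 =>
      h.ne' (measure_mono_null Set.inter_subset_left h0)
    exact ⟨ENNReal.mul_pos (ENNReal.inv_ne_zero.2 (measure_ne_top _ _)) h.ne',
      ENNReal.mul_lt_top (ENNReal.inv_lt_top.2 (pos_of_ne_zero h1)) (measure_lt_top _ _)⟩

/-- For each `n`, a static particle at 0 and the absence of hits on either side are three
independent events, of joint probability at least `p * δ * δ`. As this is uniform in `n`, it passes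
to the decreasing limit. -/
theorem theta_pos_of_not_hit (m : Measure (Set.Ioi (0 : ℝ))) [IsProbabilityMeasure m]
    (hp : p ∈ Set.Ioo (0 : ℝ) 1) {δ : ℝ} (hδ : 0 < δ)
    (h : ∀ n, δ ≤ (halfLineLaw m p).real {ω | ¬ Hit n ω}) : 0 < theta m p := by
  have hp' := Set.Ioo_subset_Icc_self hp
  have := isProbabilityMeasure_markLaw m hp'
  have : IsProbabilityMeasure (fullLineLaw m p) := by unfold fullLineLaw; infer_instance
  have : IsProbabilityMeasure (halfLineLaw m p) := by unfold halfLineLaw; infer_instance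
  rw [theta_pos_iff m hp']
  set A : Set (ℤ → Mark) := {ω | (fullLine ω).vel 0 = 0} with hA
  set R : ℕ → Set (ℤ → Mark) := fun n => window 1 ⁻¹' {ω | ¬ Hit n ω} with hR
  set L : ℕ → Set (ℤ → Mark) := fun n => leftData ⁻¹' {ω | ¬ Hit n ω} with hL
  have hAm : MeasurableSet A :=
    measurableSet_eq_fun (by unfold fullLine; fun_prop) measurable_const
  have hHm : ∀ n, MeasurableSet {ω | ¬ Hit n ω} := fun n =>
    measurableSet_setOfPred.2 (measurable_hit n).not
  have hRm : ∀ n, MeasurableSet (R n) := fun n => (measurePreserving_window 1 hp' (m := m)).measurable (hHm n)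
  have hLm : ∀ n, MeasurableSet (L n) := fun n => (measurePreserving_leftData hp' (m := m)).measurable (hHm n)
  have hlow : ∀ n, ENNReal.ofReal δ ≤ halfLineLaw m p {ω | ¬ Hit n ω} := fun n =>
    ENNReal.ofReal_le_of_le_toReal (h n)
  have hPA : fullLineLaw m p A = ENNReal.ofReal p := by
    have h1 := (measurePreserving_eval_infinitePi (fun _ : ℤ => markLaw m p) 0).measure_preimage
      (measurableSet_eq_fun (f := fun x : Mark => x.2.1) (g := fun _ => 0) (by fun_prop)
        measurable_const).nullMeasurableSet
    rw [← markLaw_static (m := m) hp', ← h1]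
    rfl
  -- The first gap of `leftData ω` is that of the mark of particle 0; since a hit ignores it, only
  -- strictly negative indices matter.
  have hLdep : ∀ (n : ℕ) (ω ω' : ℤ → Mark), (∀ i ∈ Finset.Ico (-n : ℤ) 0, ω i = ω' i) →
      (ω ∈ L n ↔ ω' ∈ L n) := by
    intro n ω ω' hω
    refine not_congr (hit_congr ?_ ?_)
    · intro i hi
      simp only [leftData]
      rw [hω (-1 - i) (Finset.mem_Ico.2 ⟨by omega, by omega⟩)]
    · intro i hi hi0
      simp only [leftData]
      rw [hω (-i) (Finset.mem_Ico.2 ⟨by omega, by omega⟩)]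
  have hRdep : ∀ (n : ℕ) (ω ω' : ℤ → Mark), (∀ i ∈ Finset.Icc (1 : ℤ) n, ω i = ω' i) →
      (ω ∈ R n ↔ ω' ∈ R n) := by
    intro n ω ω' hω
    refine not_congr (hit_congr ?_ ?_)
    · intro i hi
      simp only [window]
      rw [hω (i + 1) (Finset.mem_Icc.2 ⟨by omega, by omega⟩)]
    · intro i hi hi0
      simp only [window]
      rw [hω (i + 1) (Finset.mem_Icc.2 ⟨by omega, by omega⟩)]
  have hprod : ∀ n, ENNReal.ofReal p * (ENNReal.ofReal δ * ENNReal.ofReal δ) ≤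
      fullLineLaw m p (A ∩ (R n ∩ L n)) := by
    intro n
    have h1 : fullLineLaw m p (R n ∩ L n) = fullLineLaw m p (R n) * fullLineLaw m p (L n) := by
      refine infinitePi_inter_of_disjoint (s := Finset.Icc (1 : ℤ) n) (t := Finset.Ico (-n : ℤ) 0)
        ?_ (hRm n) (hLm n) (hRdep n) (hLdep n)
      refine Finset.disjoint_left.2 fun i hi hi' => ?_
      rw [Finset.mem_Icc] at hi
      rw [Finset.mem_Ico] at hi'
      omega
    have h2 : fullLineLaw m p (A ∩ (R n ∩ L n)) =
        fullLineLaw m p A * fullLineLaw m p (R n ∩ L n) := by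
      refine infinitePi_inter_of_disjoint (s := {0})
        (t := Finset.Icc (1 : ℤ) n ∪ Finset.Ico (-n : ℤ) 0) ?_ hAm ((hRm n).inter (hLm n)) ?_ ?_
      · simp
      · intro ω ω' hω
        simp only [hA, Set.mem_ofPred_eq, fullLine, hω 0 (by simp)]
      · intro ω ω' hω
        exact and_congr (hRdep n ω ω' fun i hi => hω i (Finset.mem_union_left _ hi))
          (hLdep n ω ω' fun i hi => hω i (Finset.mem_union_right _ hi))
    rw [h2, h1, hPA, (measurePreserving_window 1 hp' (m := m)).measure_preimage
      (hHm n).nullMeasurableSet, (measurePreserving_leftData hp' (m := m)).measure_preimage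
      (hHm n).nullMeasurableSet]
    gcongr
    · exact hlow n
    · exact hlow n
  have hanti : Antitone fun n => A ∩ (R n ∩ L n) := by
    intro n n' hn ω hω
    exact ⟨hω.1, fun hh => hω.2.1 (Hit.mono hn hh), fun hh => hω.2.2 (Hit.mono hn hh)⟩
  have hlim := tendsto_measure_iInter_atTop (μ := fullLineLaw m p)
    (fun n => (hAm.inter ((hRm n).inter (hLm n))).nullMeasurableSet) hanti
    ⟨0, measure_ne_top _ _⟩
  have hge := ge_of_tendsto' hlim hprod
  refine lt_of_lt_of_le ?_ (hge.trans (measure_mono ?_))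
  · have h1 := ENNReal.ofReal_pos.2 hp.1
    have h2 := ENNReal.ofReal_pos.2 hδ
    exact ENNReal.mul_pos h1.ne' (ENNReal.mul_pos h2.ne' h2.ne').ne'
  · intro ω hω
    rw [Set.mem_iInter] at hω
    exact ⟨(hω 0).1, survives_of_not_hit (hω 0).1 (fun n => (hω n).2.1) fun n => (hω n).2.2⟩

end FullLine

end BallisticAnnihilation

namespace BallisticAnnihilation

/-! ### Local finiteness of the full line -/

section LocallyFinite

variable {m : Measure (Set.Ioi (0 : ℝ))} [IsProbabilityMeasure m] {p : ℝ}

theorem exists_gap_lt_one (ρ : Measure Mark) [IsProbabilityMeasure ρ] :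
    ∃ ε : ℝ, 0 < ε ∧ ρ {x | (x.1 : ℝ) < ε} < 1 := by
  have hm : ∀ ε : ℝ, MeasurableSet {x : Mark | (x.1 : ℝ) < ε} := fun ε =>
    measurableSet_lt (by fun_prop) measurable_const
  have hlim := tendsto_measure_iInter_atTop (μ := ρ)
    (s := fun n : ℕ => {x : Mark | (x.1 : ℝ) < 1 / ((n : ℝ) + 1)})
    (fun n => (hm _).nullMeasurableSet)
    (fun a b hab x (hx : (x.1 : ℝ) < 1 / ((b : ℝ) + 1)) =>
      show (x.1 : ℝ) < 1 / ((a : ℝ) + 1) from hx.trans_le (Nat.one_div_le_one_div hab)) ⟨0, measure_ne_top _ _⟩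
  have hempty : ⋂ n : ℕ, {x : Mark | (x.1 : ℝ) < 1 / ((n : ℝ) + 1)} = ∅ := by
    refine Set.eq_empty_of_forall_notMem fun x hx => ?_
    obtain ⟨n, hn⟩ := exists_nat_one_div_lt x.1.2.out
    exact lt_asymm hn (Set.mem_iInter.1 hx n)
  rw [hempty, measure_empty] at hlim
  obtain ⟨n, hn⟩ := (hlim.eventually (gt_mem_nhds zero_lt_one)).exists
  exact ⟨_, Nat.one_div_pos_of_nat, hn⟩

theorem infinitePi_forall_lt_eq_zero {ρ : Measure Mark} [IsProbabilityMeasure ρ] {ε : ℝ}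
    (h : ρ {x | (x.1 : ℝ) < ε} < 1) {f : ℕ → ℤ} (hf : Function.Injective f) :
    Measure.infinitePi (fun _ : ℤ => ρ) {ω | ∀ n, ((ω (f n)).1 : ℝ) < ε} = 0 := by
  have hm : MeasurableSet {x : Mark | (x.1 : ℝ) < ε} :=
    measurableSet_lt (by fun_prop) measurable_const
  refine le_antisymm (ge_of_tendsto' (ENNReal.tendsto_pow_atTop_nhds_zero_of_lt_one h)
    fun M => ?_) zero_le
  have h1 := Measure.infinitePi_pi (fun _ : ℤ => ρ) (s := (Finset.range M).image f)
    (t := fun _ => {x : Mark | (x.1 : ℝ) < ε}) fun _ _ => hm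
  rw [Finset.prod_const, Finset.card_image_of_injective _ hf, Finset.card_range] at h1
  rw [← h1]
  refine measure_mono fun ω hω i hi => ?_
  obtain ⟨n, -, rfl⟩ := Finset.mem_image.1 (Finset.mem_coe.1 hi)
  exact hω n

theorem locallyFinite_fullLine_of_gaps {ω : ℤ → Mark} {ε : ℝ} (hε : 0 < ε)
    (hr : ∀ N : ℕ, ∃ n : ℕ, ε ≤ (ω (N + n + 1)).1) (hl : ∀ N : ℕ, ∃ n : ℕ, ε ≤ (ω (-N - n)).1) :
    (fullLine ω).LocallyFinite Set.univ := by
  have hc := strictMono_fullLine ω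
  have h0 : (fullLine ω).pos 0 = 0 := by simp [fullLine]
  have hR : ∀ M : ℕ, ∃ N : ℕ, M * ε ≤ (fullLine ω).pos N := by
    intro M
    induction M with
    | zero => exact ⟨0, by simp [h0]⟩
    | succ M ih =>
      obtain ⟨N, hN⟩ := ih
      obtain ⟨n, hn⟩ := hr N
      refine ⟨N + n + 1, ?_⟩
      push_cast
      rw [fullLine_pos_add_one]
      have := hc.monotone (show (N : ℤ) ≤ N + n by omega)
      linarith
  have hL : ∀ M : ℕ, ∃ N : ℕ, (fullLine ω).pos (-N) ≤ -(M * ε) := by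
    intro M
    induction M with
    | zero => exact ⟨0, by simp [h0]⟩
    | succ M ih =>
      obtain ⟨N, hN⟩ := ih
      obtain ⟨n, hn⟩ := hl N
      refine ⟨N + n + 1, ?_⟩
      rw [show (-((N + n + 1 : ℕ) : ℤ)) = (-N - n) - 1 by push_cast; ring, fullLine_pos_sub_one]
      have := hc.monotone (show (-N - n : ℤ) ≤ -N by omega)
      push_cast
      linarith
  intro x r
  obtain ⟨M, hM⟩ := exists_nat_gt ((|x| + r) / ε)
  rw [div_lt_iff₀ hε] at hM
  obtain ⟨a, ha⟩ := hR M
  obtain ⟨b, hb⟩ := hL M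
  refine (Set.finite_Icc (-(b : ℤ)) a).subset ?_
  rintro i ⟨-, hi⟩
  rw [abs_le] at hi
  constructor
  · by_contra! hlt
    have := hc hlt
    linarith [neg_abs_le x]
  · by_contra! hlt
    have := hc hlt
    linarith [le_abs_self x]

/-- Gaps are positive, so some `ε` is exceeded with positive probability, hence infinitely often on
each side: the locations diverge both ways, whatever the moments of `m`. -/
theorem ae_locallyFinite (hp : p ∈ Set.Icc (0 : ℝ) 1) :
    ∀ᵐ ω ∂(fullLineLaw m p), (fullLine ω).LocallyFinite Set.univ := by
  have := isProbabilityMeasure_markLaw m hp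
  obtain ⟨ε, hε, hlt⟩ := exists_gap_lt_one (markLaw m p)
  have hR : ∀ᵐ ω ∂(fullLineLaw m p), ∀ N : ℕ, ∃ n : ℕ, ε ≤ ((ω (N + n + 1)).1 : ℝ) := by
    rw [ae_all_iff]
    intro N
    have := infinitePi_forall_lt_eq_zero hlt (f := fun n : ℕ => (N : ℤ) + n + 1)
      fun i j h => by simpa using h
    filter_upwards [measure_eq_zero_iff_ae_notMem.1 this] with ω hω
    simpa using hω
  have hL : ∀ᵐ ω ∂(fullLineLaw m p), ∀ N : ℕ, ∃ n : ℕ, ε ≤ ((ω (-N - n)).1 : ℝ) := by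
    rw [ae_all_iff]
    intro N
    have := infinitePi_forall_lt_eq_zero hlt (f := fun n : ℕ => -(N : ℤ) - n)
      fun i j h => by simpa using h
    filter_upwards [measure_eq_zero_iff_ae_notMem.1 this] with ω hω
    simpa using hω
  filter_upwards [hR, hL] with ω h1 h2
  exact locallyFinite_fullLine_of_gaps hε h1 h2

end LocallyFinite

/-! ### Growth of the mean count when static particles survive -/

section Growth

variable {m : Measure (Set.Ioi (0 : ℝ))} [IsProbabilityMeasure m] {p : ℝ}

/-- A left-moving particle exits on the left. -/
def Exit (i : ℕ) (ω : ℕ → Mark) : Prop :=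
  (halfLine ω).vel i = -1 ∧ (halfLine ω).Survives (Set.Iic i) i

/-- If the left-moving particle `i'` exits after `i` did, then it exits on the left of the process
started after `i`. -/
theorem Exit.hit_shift {i i' : ℕ} {ω : ℕ → Mark} (h : Exit i ω) (h' : Exit i' ω) (hii : i < i') :
    Hit (i' - i) (shift (i + 1) ω) := by
  have hc := strictMono_halfLine ω
  have hLF : (halfLine ω).LocallyFinite (Set.Iic i') :=
    Config.locallyFinite_of_finite (Set.finite_Iic i')
  have hset : Set.Iic i' ∩ Set.Iic i = Set.Iic i := by
    ext x; simp only [Set.mem_inter_iff, Set.mem_Iic]; omega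
  have h1 : (halfLine ω).Survives (Set.Iic i' ∩ Set.Iic i) i := by
    rw [hset]
    exact h.2
  have h2 := h1.inter_Ioi hc hLF h.1 h'.2 hii
  have hsum : i' - i - 1 + (i + 1) = i' := by omega
  refine ⟨i' - i - 1, by omega, ?_, ?_⟩
  · have h3 := h'.1
    simp only [halfLine, shift, hsum] at h3 ⊢
    exact h3
  · rw [← (similar_shift (i + 1) ω _).survives_iff (strictMono_halfLine _).injective hc.injective]
    simp only [hsum]
    convert h2 using 1
    ext x
    simp only [Set.mem_image, Set.mem_Iic, Set.mem_inter_iff, Set.mem_Ioi]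
    exact ⟨by rintro ⟨y, hy, rfl⟩; omega, fun hx => ⟨x - (i + 1), by omega, by omega⟩⟩

/-- The mean number of particles exiting on the left is bounded when, with positive probability,
none does. -/
theorem mul_sum_exit_le {ρ : Measure Mark} [IsProbabilityMeasure ρ] {η : ℝ}
    (h : ∀ n, η ≤ (Measure.infinitePi fun _ : ℕ => ρ).real {ω | ¬ Hit n ω}) (n : ℕ) :
    (∑ i ∈ Finset.range n, (Measure.infinitePi fun _ : ℕ => ρ).real {ω | Exit i ω}) * η ≤ 1 := by
  set P := Measure.infinitePi fun _ : ℕ => ρ with hP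
  have hEm : ∀ i, MeasurableSet {ω | Exit i ω} := fun i => measurableSet_setOfPred.2 (measurable_exit i)
  have hHm : MeasurableSet {ω | ¬ Hit n ω} := measurableSet_setOfPred.2 (measurable_hit n).not
  -- The event on the right says that `i` exits and that the process restarted after it has no hit.
  -- For distinct `i` below `n` these events are disjoint, because a later exit is a hit for the
  -- restarted process.
  have hterm : ∀ i, P.real {ω | Exit i ω} * η ≤
      P.real ({ω | Exit i ω} ∩ shift (i + 1) ⁻¹' {ω | ¬ Hit n ω}) := by
    intro i
    have hind : P ({ω | Exit i ω} ∩ shift (i + 1) ⁻¹' {ω | ¬ Hit n ω}) =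
        P {ω | Exit i ω} * P (shift (i + 1) ⁻¹' {ω | ¬ Hit n ω}) := by
      refine infinitePi_inter_of_disjoint (s := Finset.range (i + 1))
        (t := Finset.Ico (i + 1) (n + (i + 1))) ?_ (hEm i) (measurable_shift _ hHm) ?_ ?_
      · refine Finset.disjoint_left.2 fun j hj hj' => ?_
        rw [Finset.mem_range] at hj
        rw [Finset.mem_Ico] at hj'
        omega
      · intro ω ω' hω
        have hω' : ∀ j < i + 1, ω j = ω' j := fun j hj => hω j (Finset.mem_range.2 hj)
        refine and_congr ?_ (survives_iff_of_eqOn (n := i + 1) (fun j hj => by rw [hω' j hj])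
          (fun j hj _ => by rw [hω' j hj]) (fun j hj => Nat.lt_succ_of_le hj) i)
        simp [halfLine, hω' i (by omega)]
      · intro ω ω' hω
        have hω' : ∀ j < n, shift (i + 1) ω j = shift (i + 1) ω' j := fun j hj =>
          hω _ (Finset.mem_Ico.2 ⟨by omega, by omega⟩)
        exact not_congr (hit_congr (fun j hj => by rw [hω' j hj]) fun j hj _ => by rw [hω' j hj])
    have hshift : P (shift (i + 1) ⁻¹' {ω | ¬ Hit n ω}) = P {ω | ¬ Hit n ω} :=
      (measurePreserving_comp_injective (ρ := ρ) (add_left_injective (i + 1))).measure_preimage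
        hHm.nullMeasurableSet
    rw [measureReal_def P (_ ∩ _), hind, hshift, ENNReal.toReal_mul]
    exact mul_le_mul_of_nonneg_left (h n) measureReal_nonneg
  rw [Finset.sum_mul]
  refine (Finset.sum_le_sum fun i _ => hterm i).trans ?_
  rw [← measureReal_biUnion_finset]
  · exact measureReal_le_one
  · have key : ∀ i i', i < i' → i' < n → ∀ ω, ω ∈ {ω | Exit i ω} ∩ shift (i + 1) ⁻¹' {ω | ¬ Hit n ω} →
        ω ∉ {ω | Exit i' ω} ∩ shift (i' + 1) ⁻¹' {ω | ¬ Hit n ω} := by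
      rintro i i' hii hn ω ⟨h1, h2⟩ ⟨h3, -⟩
      exact h2 ((Exit.hit_shift h1 h3 hii).mono (by omega))
    intro i hi i' hi' hne
    have hi := Finset.mem_range.1 (Finset.mem_coe.1 hi)
    have hi' := Finset.mem_range.1 (Finset.mem_coe.1 hi')
    refine Set.disjoint_left.2 fun ω h1 h2 => ?_
    rcases lt_or_gt_of_ne hne with hlt | hlt
    · exact key i i' hlt hi' ω h1 h2
    · exact key i' i hlt hi ω h2 h1
  · exact fun i _ => (hEm i).inter (measurable_shift _ hHm)

theorem exit_iff {i n : ℕ} (hin : i < n) (ω : ℕ → Mark) :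
    ((halfLine ω).vel i = -1 ∧ (halfLine ω).Survives (Finset.range n) i) ↔ Exit i ω := by
  refine and_congr_right fun hv => ?_
  refine Config.survives_iff_of_vel_eq_neg_one (strictMono_halfLine ω)
    (Config.locallyFinite_of_finite (Finset.finite_toSet _))
    (Config.locallyFinite_of_finite (Set.finite_Iic i)) hv ?_
  ext x
  simp only [Finset.coe_range, Set.mem_inter_iff, Set.mem_Iio, Set.mem_Iic]
  omega

theorem integral_netCount {ρ : Measure Mark} [IsProbabilityMeasure ρ] (n : ℕ) :
    ∫ ω, (netCount n ω : ℝ) ∂(Measure.infinitePi fun _ : ℕ => ρ) =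
      ∑ i ∈ Finset.range n, ((Measure.infinitePi fun _ : ℕ => ρ).real
        {ω | (halfLine ω).vel i = 0 ∧ (halfLine ω).Survives (Finset.range n) i} -
        (Measure.infinitePi fun _ : ℕ => ρ).real {ω | Exit i ω}) := by
  set P := Measure.infinitePi fun _ : ℕ => ρ with hP
  have hEm : ∀ i, MeasurableSet {ω | Exit i ω} := fun i => measurableSet_setOfPred.2 (measurable_exit i)
  have hSm : ∀ i, MeasurableSet
      {ω | (halfLine ω).vel i = 0 ∧ (halfLine ω).Survives (Finset.range n) i} := by
    intro i
    refine measurableSet_setOfPred.2 (Measurable.and ?_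
      (isMeasurable_halfLine.measurable_survives (Finset.finite_toSet _) i))
    exact measurableSet_setOfPred.1 (measurableSet_eq_fun (measurable_halfLine_vel i) measurable_const)
  have h1 : ∀ ω, (netCount n ω : ℝ) = ∑ i ∈ Finset.range n,
      ({ω | (halfLine ω).vel i = 0 ∧ (halfLine ω).Survives (Finset.range n) i}.indicator
        (fun _ => (1 : ℝ)) ω - {ω | Exit i ω}.indicator (fun _ => (1 : ℝ)) ω) := by
    intro ω
    rw [netCount_eq, Config.netSum, Int.cast_sum]
    refine Finset.sum_congr rfl fun i hi => ?_
    classical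
    simp only [Set.indicator_apply, Set.mem_ofPred_eq, ← exit_iff (Finset.mem_range.1 hi) ω]
    clear hSm
    generalize ((Finset.range n : Finset ℕ) : Set ℕ) = T
    by_cases hs : (halfLine ω).Survives T i
    · rcases Config.vel_cases (halfLine ω) i with h | h | h <;> simp [Config.charge, h, hs]
    · simp [hs]
  simp_rw [h1]
  rw [integral_finsetSum]
  · refine Finset.sum_congr rfl fun i _ => ?_
    rw [integral_sub ((integrable_const _).indicator (hSm i))
      ((integrable_const _).indicator (hEm i)), integral_indicator_const _ (hSm i),
      integral_indicator_const _ (hEm i), smul_eq_mul, smul_eq_mul, mul_one, mul_one]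
  · exact fun i _ => ((integrable_const _).indicator (hSm i)).sub
      ((integrable_const _).indicator (hEm i))

theorem survives_window {ω : ℤ → Mark} (hLF : (fullLine ω).LocallyFinite Set.univ)
    (h0 : (fullLine ω).vel 0 = 0) (hs : (fullLine ω).Survives Set.univ 0) {i n : ℕ} (hin : i < n) :
    (halfLine (window (-i) ω)).vel i = 0 ∧
      (halfLine (window (-i) ω)).Survives (Finset.range n) i := by
  have hc := strictMono_fullLine ω
  refine ⟨by simpa [halfLine, window, fullLine] using h0, ?_⟩
  rw [← (similar_window (-i) ω _).survives_iff (strictMono_halfLine _).injective hc.injective]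
  have h1 := Config.Survives.inter_Icc (a := -(i : ℤ)) (b := n - 1 - i) hc hLF hs h0
    (by omega) (by omega)
  simp only [add_neg_cancel]
  convert h1 using 1
  ext x
  simp only [Finset.coe_range, Set.mem_image, Set.mem_Iio, Set.univ_inter, Set.mem_Icc]
  exact ⟨by rintro ⟨y, hy, rfl⟩; omega, fun hx => ⟨(x + i).toNat, by omega, by omega⟩⟩

/-- Static survivors contribute at least `n * η` to the mean count, a linear growth, whereas
left-moving ones cost at most `1 / η`. -/
theorem exists_integral_netCount_pos (m : Measure (Set.Ioi (0 : ℝ))) [IsProbabilityMeasure m]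
    (hp : p ∈ Set.Icc (0 : ℝ) 1) (hθ : 0 < theta m p) :
    ∃ k : ℕ, 1 ≤ k ∧ 0 < ∫ ω, (netCount k ω : ℝ) ∂(halfLineLaw m p) := by
  have := isProbabilityMeasure_markLaw m hp
  have : IsProbabilityMeasure (fullLineLaw m p) := by unfold fullLineLaw; infer_instance
  have : IsProbabilityMeasure (halfLineLaw m p) := by unfold halfLineLaw; infer_instance
  rw [theta_pos_iff m hp] at hθ
  set A : Set (ℤ → Mark) := {ω | (fullLine ω).vel 0 = 0} ∩
    {ω | (fullLine ω).Survives Set.univ 0} with hA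
  set η := (fullLineLaw m p).real A with hη
  have hη0 : 0 < η := ENNReal.toReal_pos hθ.ne' (measure_ne_top _ _)
  -- Every window of the full line has the half-line law, so a consequence of the survival of 0 in
  -- some window bounds a half-line probability from below by `η`.
  have htransfer : ∀ (k : ℤ) (B : Set (ℕ → Mark)), MeasurableSet B →
      (∀ ω ∈ A, (fullLine ω).LocallyFinite Set.univ → window k ω ∈ B) →
      η ≤ (halfLineLaw m p).real B := by
    intro k B hB h
    rw [measureReal_def, ← (measurePreserving_window k hp).measure_preimage hB.nullMeasurableSet]
    refine ENNReal.toReal_mono (measure_ne_top _ _) (measure_mono_ae ?_)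
    filter_upwards [ae_locallyFinite (m := m) hp] with ω hω hωA
    exact h ω hωA hω
  have hnohit : ∀ n, η ≤ (halfLineLaw m p).real {ω | ¬ Hit n ω} := fun n =>
    htransfer 1 _ (measurableSet_setOfPred.2 (measurable_hit n).not)
      fun ω hω hLF => not_hit_of_survives hLF hω.1 hω.2 n
  have hsurv : ∀ i n, i < n → η ≤ (halfLineLaw m p).real
      {ω | (halfLine ω).vel i = 0 ∧ (halfLine ω).Survives (Finset.range n) i} := by
    intro i n hin
    refine htransfer (-i) _ ?_ fun ω hω hLF => survives_window hLF hω.1 hω.2 hin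
    refine measurableSet_setOfPred.2 (Measurable.and ?_
      (isMeasurable_halfLine.measurable_survives (Finset.finite_toSet _) i))
    exact measurableSet_setOfPred.1 (measurableSet_eq_fun (measurable_halfLine_vel i) measurable_const)
  obtain ⟨n, hn⟩ := exists_nat_gt (1 / (η * η))
  rw [div_lt_iff₀ (mul_pos hη0 hη0)] at hn
  refine ⟨n, ?_, ?_⟩
  · rcases Nat.eq_zero_or_pos n with rfl | h
    · norm_num at hn
    · exact h
  have h1 := integral_netCount (ρ := markLaw m p) n
  have h2 := mul_sum_exit_le hnohit n
  have h3 : n * η ≤ ∑ i ∈ Finset.range n, (halfLineLaw m p).real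
      {ω | (halfLine ω).vel i = 0 ∧ (halfLine ω).Survives (Finset.range n) i} := by
    have := Finset.card_nsmul_le_sum (Finset.range n) _ η fun i hi =>
      hsurv i n (Finset.mem_range.1 hi)
    simpa using this
  rw [Finset.sum_sub_distrib] at h1
  rw [halfLineLaw, h1]
  rw [halfLineLaw] at h3
  set a := ∑ i ∈ Finset.range n, (Measure.infinitePi fun _ : ℕ => markLaw m p).real {ω | Exit i ω}
  have h4 : a * η < n * η * η := by linarith
  have h5 : a < n * η := lt_of_mul_lt_mul_right h4 hη0.le
  linarith

end Growth

end BallisticAnnihilation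

theorem mainTheorem6 (m : MeasureTheory.Measure (Set.Ioi (0 : ℝ)))
    [MeasureTheory.IsProbabilityMeasure m] (p : ℝ) (hp : p ∈ Set.Ioo (0 : ℝ) 1) :
    0 < BallisticAnnihilation.theta m p ↔
      ∃ k : ℕ, 1 ≤ k ∧
        0 < ∫ ω, (BallisticAnnihilation.netCount k ω : ℝ) ∂(BallisticAnnihilation.halfLineLaw m p) := by
  have hp' := Set.Ioo_subset_Icc_self hp
  have := BallisticAnnihilation.isProbabilityMeasure_markLaw m hp'
  constructor
  · exact BallisticAnnihilation.exists_integral_netCount_pos m hp'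
  · rintro ⟨k, hk, h⟩
    obtain ⟨δ, hδ, hδn⟩ := BallisticAnnihilation.exists_le_measureReal_not_hit hk
      (by rw [BallisticAnnihilation.markLaw_static hp']; exact ENNReal.ofReal_pos.2 hp.1) h
    exact BallisticAnnihilation.theta_pos_of_not_hit m hp hδ hδn
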